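/- **Setting.** Let $\mathcal S,\mathcal A,\mathcal Z$ be finite sets. A confounded MDP consists of a transition kernel $P(\cdot|s,a)\in\Delta(\mathcal S)$, confounder laws $P_{\mathcal E}(\cdot|s,a)\in\Delta(\mathcal E)$ with $\mathcal E\subseteq[-1,1]$, a reward function $R:\mathcal S\times\mathcal A\to\mathbb R$ and a discount factor $\gamma\in[0,1)$. Let $\pi$ be a target policy, $\pi(\cdot|s)\in\Delta(\mathcal A)$. Its value function is $V(s)=\mathbb E\big[\sum_{t\ge1}\gamma^{t-1}r^{(t)}\,\big|\,s^{(1)}=s\big]$, where $a^{(t)}\sim\pi(\cdot|s^{(t)})$, $\epsilon^{(t)}\sim P_0$ independently with $P_0\in\Delta(\mathcal E)$ of mean zero, $r^{(t)}=R(s^{(t)},a^{(t)})+\epsilon^{(t)}$ and $s^{(t+1)}\sim P(\cdot|s^{(t)},a^{(t)})$. The offline data are i.i.d. samples $X_i=(s_i,a_i,z_i,r_i,s_i')$, $i=1,2,\dots$, generated by $z_i\sim p$, $(s_i,a_i)\sim\rho(\cdot,\cdot|z_i)$, $\epsilon_i\sim P_{\mathcal E}(\cdot|s_i,a_i)$,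 $r_i=R(s_i,a_i)+\epsilon_i$, $s_i'\sim P(\cdot|s_i,a_i)$, where $p(z)>0$ for all $z\in\mathcal Z$; $\epsilon_i$ is not observed. The conditional probabilities $\rho=(\rho(s,a|z))$ are regarded as an element of $\mathbb R^{\mathcal S\times\mathcal A\times\mathcal Z}$. Assume: 1. (Linear structure) There are a known $\phi:\mathcal S\times\mathcal A\to\mathbb R^d$ and unknown $\nu:\mathcal S\to\mathbb R^d$, $w\in\mathbb R^d$ with $P(s'|s,a)=\phi(s,a)^\top\nu(s')$, $R(s,a)=\phi(s,a)^\top w$, $\sup_{s,a}\|\phi(s,a)\|_2\le1$, $\|w\|_2\le1$ and $\sup_a\big\|\sum_s\nu(s)\phi(s,a)^\top\big\|\le1$ (operator $\ell_2$-norm). 2. (Instrumental variable) $z_i\perp\!\!\!\perp\epsilon_i\mid(s_i,a_i)$ and $\mathbb E[\epsilon_i|z_i]=0$. 3. (Coverage) $\Sigma=\sum_z p(z)\phi_\rho(z)\phi_\rho(z)^\top$ is non-singular, i.e. its smallest eigenvalue is positive, where $\phi_r(z)=\sum_{s,a}r(s,a,z)\,\phi(s,a)$ for $r\in\mathbb R^{\mathcal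 S\times\mathcal A\times\mathcal Z}$. Put $\phi_\pi(s)=\sum_a\pi(a|s)\phi(s,a)$, $\Phi_\pi=(\phi_\pi(s))_{s\in\mathcal S}\in\mathbb R^{d\times\mathcal S}$, $\tau=\mathbb E[\phi_\rho(z_1)r_1]$, $B=\mathbb E[\phi_\rho(z_1)\phi_\pi(s_1')^\top]$, $A=\Sigma^{-1}B$ and $\theta=(I-\gamma A)^{-1}\Sigma^{-1}\tau$. **Estimator.** From $X_1,\dots,X_n$ let $$\hat\rho(s,a|z)=\frac{\sum_{i=1}^n\mathbb 1\{s_i=s,a_i=a,z_i=z\}}{\max\{\sum_{i=1}^n\mathbb 1\{z_i=z\},1\}},$$ $\hat\Sigma=\frac1n\sum_i\phi_{\hat\rho}(z_i)\phi_{\hat\rho}(z_i)^\top$, $\hat\tau=\frac1n\sum_i\phi_{\hat\rho}(z_i)r_i$, $\hat B=\frac1n\sum_i\phi_{\hat\rho}(z_i)\phi_\pi(s_i')^\top$, $\hat A=\hat\Sigma^{-1}\hat B$, $\hat\theta=(I-\gamma\hat A)^{-1}\hat\Sigma^{-1}\hat\tau$ and $\hat V(s)=\phi_\pi(s)^\top\hat\theta$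 (with an arbitrary fixed convention where an inverse does not exist). **Influence function.** For $x=(s_x,a_x,z_x,r_x,s_x')$, $r,y\in\mathbb R^{\mathcal S\times\mathcal A\times\mathcal Z}$ let $$f(x;r)=(I-\gamma A)^{-1}\Sigma^{-1}\phi_r(z_x)\big(r_x+\gamma\,\phi_\pi(s_x')^\top\theta-\phi_r(z_x)^\top\theta\big),$$ $$g^{(s,a,z)}(x)=\mathbb 1\{s_x=s,a_x=a,z_x=z\},\qquad d^{(s,a,z)}(y)=\frac{y^{(s,a,z)}}{\sum_{s',a'}y^{(s',a',z)}},$$ $$h(x;\rho)=f(x;\rho)+\nabla_r\,\mathbb E[f(X_1;r)]\big|_{r=\rho}\;\nabla d\big(\mathbb E[g(X_1)]\big)\,g(x),$$ where in $\nabla_r\mathbb E[f(X_1;r)]$ the law of $X_1$ and the quantities $A,\Sigma,\theta$ are held fixed at their true values. **Theorem (asymptotic linearity).** Under these assumptions all these quantities are well defined ($I-\gamma A$ is invertible, $f(X_1;r)$ and $h(X_1;\rho)$ are integrable, the two derivatives exist), and, as $n\to\infty$, the vectors $\hat V=(\hat V(s))_{s}$ and $V=(V(s))_{s}$ satisfy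 $$\sqrt n\,(\hat V-V)=\frac1{\sqrt n}\sum_{i=1}^n\Phi_\pi^\top\big(h(X_i;\rho)-\mathbb E[h(X_1;\rho)]\big)+o_P(1),$$ where $o_P(1)$ denotes a sequence of random vectors converging to $0$ in probability. -/

import Mathlib

open MeasureTheory ProbabilityTheory Filter
open scoped Matrix ENNReal Topology

noncomputable section

namespace ConfoundedOPE

/-- A confounded Markov decision process `(S, A, E, P, P_E, R, γ)`.  The confounder space `E` is a
subset of `[-1, 1]`, `P s a` is the law of the next state, `confLaw s a` the law of the confounder
`ε` given the state-action pair, `R` the deterministic reward function (the reward received is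
`R s a + ε`), and `γ ∈ [0, 1)` the discount factor. -/
structure ConfoundedMDP (S A : Type*) where
  E : Set ℝ
  E_subset : E ⊆ Set.Icc (-1) 1
  P : S → A → PMF S
  confLaw : S → A → ProbabilityMeasure ℝ
  confLaw_mem : ∀ s a, ∀ᵐ e ∂(confLaw s a : Measure ℝ), e ∈ E
  R : S → A → ℝ
  γ : ℝ
  γ_nonneg : 0 ≤ γ
  γ_lt_one : γ < 1

/-- The offline sampling mechanism: `z ∼ p` and `(s, a) ∼ ρ(·, · | z)`. -/
structure Sampling (S A Z : Type*) where
  p : PMF Z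
  ρ : Z → PMF (S × A)

/-- An observed sample `(s, a, z, r, s')`. -/
abbrev Sample (S A Z : Type*) := S × A × Z × ℝ × S

namespace Sample

variable {S A Z : Type*}

abbrev state (x : Sample S A Z) : S := x.1
abbrev action (x : Sample S A Z) : A := x.2.1
abbrev instr (x : Sample S A Z) : Z := x.2.2.1
abbrev reward (x : Sample S A Z) : ℝ := x.2.2.2.1
abbrev next (x : Sample S A Z) : S := x.2.2.2.2

end Sample

/-- A latent sample `(s, a, z, ε, s')`, with the unobserved confounder `ε` instead of the
reward. -/
abbrev Latent (S A Z : Type*) := S × A × Z × ℝ × S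

namespace Latent

variable {S A Z : Type*}

abbrev stateAction (x : Latent S A Z) : S × A := (x.1, x.2.1)
abbrev instr (x : Latent S A Z) : Z := x.2.2.1
abbrev conf (x : Latent S A Z) : ℝ := x.2.2.2.1

end Latent

/-! ### Linear structure -/

section Linear

variable {S A : Type*} [Fintype S] {d : ℕ}

/-- The linear structure of the transitions and rewards, with its normalization.  Vectors carry
the `ℓ²` norm and matrices the `ℓ²` operator norm. -/
structure LinearStructure (M : ConfoundedMDP S A) (φ : S → A → Fin d → ℝ)
    (ν : S → Fin d → ℝ) (w : Fin d → ℝ) : Prop where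
  transition : ∀ s a s', (M.P s a s').toReal = φ s a ⬝ᵥ ν s'
  reward : ∀ s a, M.R s a = φ s a ⬝ᵥ w
  norm_feature : ∀ s a, ‖WithLp.toLp 2 (φ s a)‖ ≤ 1
  norm_w : ‖WithLp.toLp 2 w‖ ≤ 1
  norm_sum : ∀ a, ‖Matrix.toEuclideanCLM (n := Fin d) (𝕜 := ℝ)
    (∑ s, Matrix.vecMulVec (ν s) (φ s a))‖ ≤ 1

end Linear

/-! ### The value function of the target policy -/

section Value

variable {S A : Type*} [Fintype S] [Fintype A] [MeasurableSpace S] [MeasurableSpace A]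

/-- The law of `(s, a, ε)` when `s ∼ μ`, `a ∼ π(· | s)`, and `ε ∼ P₀` independently. -/
def stepLaw (π : S → PMF A) (P₀ : ProbabilityMeasure ℝ) (μ : PMF S) : Measure (S × A × ℝ) :=
  ∑ s, ∑ a, (μ s * π s a) • (P₀ : Measure ℝ).map (fun e => (s, a, e))

instance stepLaw_isProbabilityMeasure (π : S → PMF A) (P₀ : ProbabilityMeasure ℝ) (μ : PMF S) :
    IsProbabilityMeasure (stepLaw π P₀ μ) := by
  constructor
  have h : ∀ (s : S) (a : A),
      ((P₀ : Measure ℝ).map (fun e => ((s, a, e) : S × A × ℝ))) Set.univ = 1 := fun s a => by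
    rw [Measure.map_apply (by fun_prop) MeasurableSet.univ]
    simp
  have hπ : ∀ s, ∑ a, π s a = 1 := fun s => by rw [← tsum_fintype (L := .unconditional _)]; exact (π s).tsum_coe
  have hμ : ∑ s, μ s = 1 := by rw [← tsum_fintype (L := .unconditional _)]; exact μ.tsum_coe
  simp only [stepLaw, Measure.finsetSum_apply, Measure.smul_apply, h, smul_eq_mul, mul_one,
    ← Finset.mul_sum, hπ, hμ]

variable [DiscreteMeasurableSpace S] [DiscreteMeasurableSpace A]

/-- One step of the evaluation trajectory: from `(s, a, ε)` to `(s', a', ε')` with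
`s' ∼ P(· | s, a)`, `a' ∼ π(· | s')`, and `ε' ∼ P₀`. -/
def stepKernel (M : ConfoundedMDP S A) (π : S → PMF A) (P₀ : ProbabilityMeasure ℝ) :
    Kernel (S × A × ℝ) (S × A × ℝ) where
  toFun x := stepLaw π P₀ (M.P x.1 x.2.1)
  measurable' :=
    (Measurable.of_discrete (f := fun y : S × A => stepLaw π P₀ (M.P y.1 y.2))).comp
      (g := fun y : S × A => stepLaw π P₀ (M.P y.1 y.2))
      (f := fun x : S × A × ℝ => (x.1, x.2.1)) (by fun_prop)

instance stepKernel_isMarkovKernel (M : ConfoundedMDP S A) (π : S → PMF A)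
    (P₀ : ProbabilityMeasure ℝ) : IsMarkovKernel (stepKernel M π P₀) :=
  ⟨fun x => stepLaw_isProbabilityMeasure π P₀ (M.P x.1 x.2.1)⟩

/-- The law of the trajectory `(s^(t), a^(t), ε^(t))`, with time shifted to start at `0`, induced
by the policy `π` from the initial state `s₀`. -/
def trajectoryLaw (M : ConfoundedMDP S A) (π : S → PMF A) (P₀ : ProbabilityMeasure ℝ) (s₀ : S) :
    Measure (ℕ → S × A × ℝ) :=
  Kernel.trajMeasure (X := fun _ => S × A × ℝ) (stepLaw π P₀ (PMF.pure s₀))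
    (fun n => (stepKernel M π P₀).comap
      (fun h : (i : Finset.Iic n) → S × A × ℝ => h ⟨n, Finset.mem_Iic.2 le_rfl⟩)
      (measurable_pi_apply _))

/-- The value function `V_π(s) = 𝔼_π[∑_t γ^t r^(t) | s^(0) = s]`. -/
def value (M : ConfoundedMDP S A) (π : S → PMF A) (P₀ : ProbabilityMeasure ℝ) (s₀ : S) : ℝ :=
  ∫ x, ∑' t : ℕ, M.γ ^ t * (M.R (x t).1 (x t).2.1 + (x t).2.2) ∂(trajectoryLaw M π P₀ s₀)

end Value

/-! ### The law of the offline data -/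

section Data

variable {S A Z : Type*} [Fintype S] [Fintype A] [Fintype Z]
  [MeasurableSpace S] [MeasurableSpace A] [MeasurableSpace Z]

/-- The law of `(s, a, z, ε, s')` when `z ∼ p`, `(s, a) ∼ ρ(·, · | z)`, `ε ∼ P_E(· | s, a)`, and
`s' ∼ P(· | s, a)`. -/
def latentLaw (M : ConfoundedMDP S A) (q : Sampling S A Z) : Measure (Latent S A Z) :=
  ∑ z, ∑ s, ∑ a, ∑ s', (q.p z * q.ρ z (s, a) * M.P s a s') •
    (M.confLaw s a : Measure ℝ).map (fun e => (s, a, z, e, s'))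

instance latentLaw_isProbabilityMeasure (M : ConfoundedMDP S A) (q : Sampling S A Z) :
    IsProbabilityMeasure (latentLaw M q) := by
  constructor
  have h : ∀ (s : S) (a : A) (z : Z) (s' : S), ((M.confLaw s a : Measure ℝ).map
      (fun e => ((s, a, z, e, s') : Latent S A Z))) Set.univ = 1 := fun s a z s' => by
    rw [Measure.map_apply (by fun_prop) MeasurableSet.univ]
    simp
  have hP : ∀ s a, ∑ s', M.P s a s' = 1 := fun s a => by
    rw [← tsum_fintype (L := .unconditional _)]; exact (M.P s a).tsum_coe
  have hρ : ∀ z, ∑ s, ∑ a, q.ρ z (s, a) = 1 := fun z => by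
    rw [← Fintype.sum_prod_type (f := fun y : S × A => q.ρ z y), ← tsum_fintype (L := .unconditional _)]
    exact (q.ρ z).tsum_coe
  have hp : ∑ z, q.p z = 1 := by rw [← tsum_fintype (L := .unconditional _)]; exact q.p.tsum_coe
  simp only [latentLaw, Measure.finsetSum_apply, Measure.smul_apply, h, smul_eq_mul, mul_one,
    ← Finset.mul_sum, hP, hρ, hp]

/-- The observation `(s, a, z, r, s')`, `r = R(s, a) + ε`, made of a latent sample. -/
def observe (M : ConfoundedMDP S A) (x : Latent S A Z) : Sample S A Z :=
  (x.1, x.2.1, x.2.2.1, M.R x.1 x.2.1 + x.2.2.2.1, x.2.2.2.2)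

/-- The law of one observed sample `(s, a, z, r, s')`. -/
def sampleLaw (M : ConfoundedMDP S A) (q : Sampling S A Z) : Measure (Sample S A Z) :=
  (latentLaw M q).map (observe M)

/-- The instrumental variable assumption: `z ⫫ ε | (s, a)` and `𝔼[ε | z] = 0`. -/
structure InstrumentalVariable
    [DiscreteMeasurableSpace S] [DiscreteMeasurableSpace A] [DiscreteMeasurableSpace Z]
    (M : ConfoundedMDP S A) (q : Sampling S A Z) : Prop where
  condIndep : CondIndepFun
    (MeasurableSpace.comap (Latent.stateAction (S := S) (A := A) (Z := Z)) inferInstance)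
    (Measurable.comap_le (by fun_prop))
    (Latent.instr (S := S) (A := A) (Z := Z)) Latent.conf (latentLaw M q)
  condMean : (latentLaw M q)[Latent.conf (S := S) (A := A) (Z := Z) |
    MeasurableSpace.comap (Latent.instr (S := S) (A := A) (Z := Z)) inferInstance]
      =ᵐ[latentLaw M q] 0

end Data

/-! ### Features and population quantities -/

section Population

variable {S A Z : Type*} [Fintype S] [Fintype A] [Fintype Z] {d : ℕ}

/-- The policy feature `φ_π(s) = ∑_a π(a | s) φ(s, a)`. -/
def policyFeature (φ : S → A → Fin d → ℝ) (π : S → PMF A) (s : S) : Fin d → ℝ :=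
  ∑ a, (π s a).toReal • φ s a

/-- The matrix `Φ_π ∈ ℝ^{d × S}` with columns `φ_π(s)`. -/
def policyMatrix (φ : S → A → Fin d → ℝ) (π : S → PMF A) : Matrix (Fin d) S ℝ :=
  Matrix.of fun k s => policyFeature φ π s k

/-- The conditional feature `φ_r(z) = ∑_{s,a} r(s, a, z) φ(s, a)` for an arbitrary
`r ∈ ℝ^{S × A × Z}`. -/
def condFeature (φ : S → A → Fin d → ℝ) (r : S × A × Z → ℝ) (z : Z) : Fin d → ℝ :=
  ∑ s, ∑ a, r (s, a, z) • φ s a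

/-- The conditional probabilities `ρ(s, a | z)` as an element of `ℝ^{S × A × Z}`. -/
def Sampling.rho (q : Sampling S A Z) : S × A × Z → ℝ :=
  fun y => (q.ρ y.2.2 (y.1, y.2.1)).toReal

/-- `Σ = ∑_z p(z) φ_ρ(z) φ_ρ(z)ᵀ`. -/
def covMatrix (q : Sampling S A Z) (φ : S → A → Fin d → ℝ) : Matrix (Fin d) (Fin d) ℝ :=
  ∑ z, (q.p z).toReal • Matrix.vecMulVec (condFeature φ q.rho z) (condFeature φ q.rho z)

variable [MeasurableSpace S] [MeasurableSpace A] [MeasurableSpace Z]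

/-- `τ = 𝔼[φ_ρ(z) r]`. -/
def tauVec (M : ConfoundedMDP S A) (q : Sampling S A Z) (φ : S → A → Fin d → ℝ) : Fin d → ℝ :=
  fun k => ∫ x, condFeature φ q.rho x.instr k * x.reward ∂(sampleLaw M q)

/-- `B = 𝔼[φ_ρ(z) φ_π(s')ᵀ]`. -/
def bMatrix (M : ConfoundedMDP S A) (q : Sampling S A Z) (φ : S → A → Fin d → ℝ)
    (π : S → PMF A) : Matrix (Fin d) (Fin d) ℝ :=
  Matrix.of fun k l =>
    ∫ x, condFeature φ q.rho x.instr k * policyFeature φ π x.next l ∂(sampleLaw M q)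

/-- `A = Σ⁻¹ B`. -/
def aMatrix (M : ConfoundedMDP S A) (q : Sampling S A Z) (φ : S → A → Fin d → ℝ)
    (π : S → PMF A) : Matrix (Fin d) (Fin d) ℝ :=
  (covMatrix q φ)⁻¹ * bMatrix M q φ π

/-- `θ = (I - γ A)⁻¹ w` with `w = Σ⁻¹ τ`. -/
def theta (M : ConfoundedMDP S A) (q : Sampling S A Z) (φ : S → A → Fin d → ℝ)
    (π : S → PMF A) : Fin d → ℝ :=
  (1 - M.γ • aMatrix M q φ π)⁻¹ *ᵥ ((covMatrix q φ)⁻¹ *ᵥ tauVec M q φ)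

end Population

/-! ### The two-stage estimator -/

section Estimator

variable {S A Z : Type*} [Fintype S] [Fintype A]
  [DecidableEq S] [DecidableEq A] [DecidableEq Z] {d n : ℕ}

/-- First stage: the empirical conditional probabilities `ρ̂(s, a | z)`. -/
def rhoHat (D : Fin n → Sample S A Z) : S × A × Z → ℝ := fun y =>
  (∑ i, if (D i).state = y.1 ∧ (D i).action = y.2.1 ∧ (D i).instr = y.2.2 then (1 : ℝ) else 0) /
    max (∑ i, if (D i).instr = y.2.2 then (1 : ℝ) else 0) 1

/-- `Σ̂ = n⁻¹ ∑ᵢ φ_ρ̂(zᵢ) φ_ρ̂(zᵢ)ᵀ`. -/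
def covHat (φ : S → A → Fin d → ℝ) (D : Fin n → Sample S A Z) : Matrix (Fin d) (Fin d) ℝ :=
  (n : ℝ)⁻¹ • ∑ i, Matrix.vecMulVec
    (condFeature φ (rhoHat D) (D i).instr) (condFeature φ (rhoHat D) (D i).instr)

/-- `τ̂ = n⁻¹ ∑ᵢ φ_ρ̂(zᵢ) rᵢ`. -/
def tauHat (φ : S → A → Fin d → ℝ) (D : Fin n → Sample S A Z) : Fin d → ℝ :=
  (n : ℝ)⁻¹ • ∑ i, (D i).reward • condFeature φ (rhoHat D) (D i).instr

/-- `B̂ = n⁻¹ ∑ᵢ φ_ρ̂(zᵢ) φ_π(s'ᵢ)ᵀ`. -/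
def bHat (φ : S → A → Fin d → ℝ) (π : S → PMF A) (D : Fin n → Sample S A Z) :
    Matrix (Fin d) (Fin d) ℝ :=
  (n : ℝ)⁻¹ • ∑ i, Matrix.vecMulVec
    (condFeature φ (rhoHat D) (D i).instr) (policyFeature φ π (D i).next)

/-- `θ̂ = (I - γ Â)⁻¹ ŵ` with `Â = Σ̂⁻¹ B̂` and `ŵ = Σ̂⁻¹ τ̂`. -/
def thetaHat (γ : ℝ) (φ : S → A → Fin d → ℝ) (π : S → PMF A) (D : Fin n → Sample S A Z) :
    Fin d → ℝ :=
  (1 - γ • ((covHat φ D)⁻¹ * bHat φ π D))⁻¹ *ᵥ ((covHat φ D)⁻¹ *ᵥ tauHat φ D)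

/-- The value estimator `V̂_π(s) = φ_π(s)ᵀ θ̂`. -/
def valueHat (γ : ℝ) (φ : S → A → Fin d → ℝ) (π : S → PMF A) (D : Fin n → Sample S A Z)
    (s : S) : ℝ :=
  policyFeature φ π s ⬝ᵥ thetaHat γ φ π D

end Estimator

/-! ### The influence function -/

section Influence

variable {S A Z : Type*} [Fintype S] [Fintype A] [Fintype Z]
  [DecidableEq S] [DecidableEq A] [DecidableEq Z]
  [MeasurableSpace S] [MeasurableSpace A] [MeasurableSpace Z] {d : ℕ}

/-- `f(x; r) = (I - γ A)⁻¹ Σ⁻¹ φ_r(z) (reward + γ φ_π(s')ᵀ θ - φ_r(z)ᵀ θ)`, as a function of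
`r ∈ ℝ^{S × A × Z}`; `A`, `Σ` and `θ` are the true population quantities and do not vary
with `r`. -/
def fScore (M : ConfoundedMDP S A) (q : Sampling S A Z) (φ : S → A → Fin d → ℝ)
    (π : S → PMF A) (x : Sample S A Z) (r : S × A × Z → ℝ) : Fin d → ℝ :=
  (x.reward + M.γ * (policyFeature φ π x.next ⬝ᵥ theta M q φ π)
      - condFeature φ r x.instr ⬝ᵥ theta M q φ π) •
    (((1 - M.γ • aMatrix M q φ π)⁻¹ * (covMatrix q φ)⁻¹) *ᵥ condFeature φ r x.instr)

/-- `r ↦ 𝔼[f(X; r)]`, the law of `X` being fixed. -/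
def meanScore (M : ConfoundedMDP S A) (q : Sampling S A Z) (φ : S → A → Fin d → ℝ)
    (π : S → PMF A) (r : S × A × Z → ℝ) : Fin d → ℝ :=
  ∫ x, fScore M q φ π x r ∂(sampleLaw M q)

/-- `g^{(s,a,z)}(x) = 𝟙{sᵢ = s, aᵢ = a, zᵢ = z}`. -/
def gCount (x : Sample S A Z) : S × A × Z → ℝ := fun y =>
  if x.state = y.1 ∧ x.action = y.2.1 ∧ x.instr = y.2.2 then 1 else 0

/-- `𝔼[g(X)]`. -/
def meanCount (M : ConfoundedMDP S A) (q : Sampling S A Z) : S × A × Z → ℝ :=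
  ∫ x, gCount x ∂(sampleLaw M q)

/-- `d^{(s,a,z)}(x) = x^{(s,a,z)} / ∑_{s',a'} x^{(s',a',z)}`. -/
def dNormalize (x : S × A × Z → ℝ) : S × A × Z → ℝ := fun y =>
  x y / ∑ s, ∑ a, x (s, a, y.2.2)

/-- `h(x; ρ) = f(x; ρ) + ∇_ρ 𝔼[f(X; ρ)] ∇d(𝔼[g(X)]) g(x)`. -/
def influence (M : ConfoundedMDP S A) (q : Sampling S A Z) (φ : S → A → Fin d → ℝ)
    (π : S → PMF A) (x : Sample S A Z) : Fin d → ℝ :=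
  fScore M q φ π x q.rho +
    fderiv ℝ (meanScore M q φ π) q.rho (fderiv ℝ dNormalize (meanCount M q) (gCount x))

end Influence

end ConfoundedOPE

end

/-!
The estimator depends on the data only through the empirical mean `Ȳ` of finitely many statistics
`stat x` of a sample: the cell indicators `𝟙{(s, a, z)}`, the rewards `𝟙{z} r` and the indicators
`𝟙{(z, s')}` (`thetaHat_eq`).  Asymptotic linearity is the delta method for the resulting map
`thetaOf` at the population mean `meanStat`, with three ingredients.

*The remainder.*  The statistics are almost surely bounded, because the confounder is, so
`√n (Ȳ - 𝔼 Y)` is bounded in probability by Chebyshev's inequality (`boundedInProbability_mean`).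
Differentiability of the map at the mean then gives a remainder `o_P(1)`
(`tendstoInMeasure_linearization`).

*The derivative.*  Matrix inverses need not be differentiated.  With
`residual = τ̂ - Σ̂ θ + γ B̂ θ` and `gain = (I - γ Â)⁻¹ Σ̂⁻¹`, one has `θ̂ - θ = gain * residual`
(`thetaOf_eq_add_gain_mulVec_residual`).  The residual vanishes at the population mean, so that the
derivative there is the population gain times the derivative of the residual
(`hasFDerivAt_thetaOf`).  The residual depends on the statistics linearly, once its features
`φ_r(z)` are fixed, and through `r = d(cell frequencies)`.  The linear part contributes `f(x; ρ)`,
and the dependence on `r` contributes `∇_r 𝔼[f(X; r)] ∇d(𝔼[g(X)]) g(x)`.  Their sum is the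
influence function (`hasFDerivAt_thetaOf_meanStat`).

*The target.*  Linearity of the transitions gives `B = Σ K` with `K = ∑_s ν(s) φ_π(s)ᵀ`, and the
instrumental variable assumption gives `τ = Σ w`.  Hence `A = K`, `θ = w + γ K θ`, and
`s ↦ φ_π(s)ᵀ θ` solves the Bellman equation of the target policy, whose only solution is the value
function (`LinearStructure.value_eq`).  A vector in the kernel of `I - γ K` yields a fixed point of
the discounted transition operator of the policy, which is zero by the maximum principle
(`LinearStructure.isUnit_one_sub_transitionMatrix`).
-/

noncomputable section

namespace ConfoundedOPE

set_option linter.unusedSectionVars false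

/-! ### The delta method for empirical means -/

section Delta

variable {Ω : Type*} [MeasurableSpace Ω] {μ : Measure Ω}

/-- The delta method: if `√n ‖Yₙ - m‖` is bounded in probability and `F` is differentiable at `m`,
the linearization of `F` at `m` computes `√n (F Yₙ - F m)` up to `o_P(1)`. -/
theorem tendstoInMeasure_linearization {E G : Type*} [NormedAddCommGroup E] [NormedSpace ℝ E]
    [NormedAddCommGroup G] [NormedSpace ℝ G] {Y : ℕ → Ω → E} {m : E} {F : E → G}
    {F' : E →L[ℝ] G} (hF : HasFDerivAt F F' m)
    (hY : ∀ δ : ℝ≥0∞, 0 < δ → ∃ C : ℝ, ∀ n : ℕ, μ {ω | C < √(n : ℝ) * ‖Y n ω - m‖} ≤ δ) :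
    TendstoInMeasure μ
      (fun (n : ℕ) ω => √(n : ℝ) • (F (Y n ω) - F m) - √(n : ℝ) • F' (Y n ω - m)) atTop
      (fun _ => 0) := by
  rw [tendstoInMeasure_iff_norm]
  intro ε hε
  rw [ENNReal.tendsto_nhds_zero]
  intro δ hδ
  obtain ⟨C₀, hC₀⟩ := hY δ hδ
  set C := max C₀ 1 with hC
  have hC1 : 1 ≤ C := le_max_right _ _
  have hCpos : 0 < C := by linarith
  have hlo := (hasFDerivAt_iff_isLittleO.1 hF).def (c := ε / (2 * C)) (by positivity)
  obtain ⟨η, hη, hball⟩ := Metric.eventually_nhds_iff.1 hlo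
  have hlarge : ∀ᶠ n : ℕ in atTop, C / η < √(n : ℝ) :=
    (Real.tendsto_sqrt_atTop.comp tendsto_natCast_atTop_atTop).eventually_gt_atTop _
  filter_upwards [hlarge] with n hn
  refine (measure_mono ?_).trans (hC₀ n)
  intro ω hω
  simp only [Set.mem_ofPred_eq] at hω ⊢
  by_contra hcon
  push Not at hcon
  have hle : √(n : ℝ) * ‖Y n ω - m‖ ≤ C := hcon.trans (le_max_left _ _)
  have hsq : 0 < √(n : ℝ) := lt_of_le_of_lt (by positivity) hn
  have hclose : ‖Y n ω - m‖ < η := by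
    have h1 : C < √(n : ℝ) * η := by rwa [div_lt_iff₀ hη] at hn
    exact lt_of_mul_lt_mul_left (hle.trans_lt h1) hsq.le
  have hrem := hball (y := Y n ω) (by rwa [dist_eq_norm])
  have : ‖√(n : ℝ) • (F (Y n ω) - F m) - √(n : ℝ) • F' (Y n ω - m) - 0‖ ≤ ε / 2 := by
    rw [sub_zero, ← smul_sub, norm_smul, Real.norm_of_nonneg hsq.le]
    calc √(n : ℝ) * ‖F (Y n ω) - F m - F' (Y n ω - m)‖
        ≤ √(n : ℝ) * (ε / (2 * C) * ‖Y n ω - m‖) := by gcongr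
      _ = ε / (2 * C) * (√(n : ℝ) * ‖Y n ω - m‖) := by ring
      _ ≤ ε / (2 * C) * C := by gcongr
      _ = ε / 2 := by field_simp
  linarith

/-- Chebyshev's inequality for the empirical mean of i.i.d. square integrable variables. -/
theorem measure_sqrt_mul_abs_mean_sub_le [IsProbabilityMeasure μ] {X : ℕ → Ω → ℝ} {a v : ℝ}
    (hL2 : ∀ i, MemLp (X i) 2 μ) (hmean : ∀ i, ∫ ω, X i ω ∂μ = a)
    (hvar : ∀ i, variance (X i) μ = v) (hind : iIndepFun X μ) {C : ℝ} (hC : 0 < C) (n : ℕ) :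
    μ {ω | C < √(n : ℝ) * |(n : ℝ)⁻¹ * ∑ i : Fin n, X i ω - a|} ≤ ENNReal.ofReal (v / C ^ 2) := by
  rcases Nat.eq_zero_or_pos n with rfl | hn
  · have : {ω : Ω | C < √((0 : ℕ) : ℝ) * |((0 : ℕ) : ℝ)⁻¹ * ∑ i : Fin 0, X i ω - a|} = ∅ := by
      ext ω; simp [hC.le]
    rw [this]; simp
  have hn' : (0 : ℝ) < n := by exact_mod_cast hn
  have hsq : 0 < √(n : ℝ) := Real.sqrt_pos.2 hn'
  have hss : √(n : ℝ) * √(n : ℝ) = n := Real.mul_self_sqrt hn'.le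
  have hS : MemLp (∑ i : Fin n, X i) 2 μ := memLp_finsetSum' _ fun i _ => hL2 i
  have hES : ∫ ω, (∑ i : Fin n, X i) ω ∂μ = n * a := by
    simp only [Finset.sum_apply]
    rw [integral_finsetSum (f := fun (i : Fin n) ω => X i ω) _
      fun i _ => (hL2 i).integrable (by norm_num)]
    simp [hmean]
  have hVS : variance (∑ i : Fin n, X i) μ = n * v := by
    rw [IndepFun.variance_sum (X := fun i : Fin n => X i) (fun i _ => hL2 i)]
    · simp [hvar]
    · intro i _ j _ hij
      exact hind.indepFun (fun h => hij (Fin.ext h))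
  have hcheb := meas_ge_le_variance_div_sq hS (c := C * √(n : ℝ)) (by positivity)
  rw [hVS, hES] at hcheb
  have hval : n * v / (C * √(n : ℝ)) ^ 2 = v / C ^ 2 := by
    rw [mul_pow, sq (√(n : ℝ)), hss]; field_simp
  rw [hval] at hcheb
  refine (measure_mono fun ω hω => ?_).trans hcheb
  simp only [Set.mem_ofPred_eq, Finset.sum_apply] at hω ⊢
  have h1 : (n : ℝ)⁻¹ * ∑ i : Fin n, X i ω - a = (n : ℝ)⁻¹ * (∑ i : Fin n, X i ω - n * a) := by
    field_simp
  rw [h1, abs_mul, abs_of_pos (inv_pos.2 hn')] at hω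
  have h2 : √(n : ℝ) * ((n : ℝ)⁻¹ * |∑ i : Fin n, X i ω - n * a|) * √(n : ℝ)
      = |∑ i : Fin n, X i ω - n * a| := by
    rw [show ∀ t : ℝ, √(n : ℝ) * ((n : ℝ)⁻¹ * t) * √(n : ℝ) = (√(n : ℝ) * √(n : ℝ)) * (n : ℝ)⁻¹ * t
      from fun t => by ring, hss, mul_inv_cancel₀ hn'.ne', one_mul]
  rw [← h2]
  exact (mul_le_mul_of_nonneg_right hω.le hsq.le)

/-- The normalized deviation `√n (Ȳₙ - 𝔼 Y)` of an empirical mean of i.i.d. almost surely bounded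
vectors is bounded in probability. -/
theorem boundedInProbability_mean [IsProbabilityMeasure μ] {𝓧 : Type*} [MeasurableSpace 𝓧]
    {P : Measure 𝓧} {X : ℕ → Ω → 𝓧} (hlaw : ∀ i, HasLaw (X i) P μ) (hind : iIndepFun X μ)
    {ι : Type*} [Fintype ι] {T : 𝓧 → ι → ℝ} (hT : Measurable T)
    (hbdd : ∀ k, ∃ K : ℝ, ∀ᵐ x ∂P, |T x k| ≤ K) (δ : ℝ≥0∞) (hδ : 0 < δ) :
    ∃ C : ℝ, ∀ n : ℕ, μ {ω | C < √(n : ℝ) *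
      ‖(n : ℝ)⁻¹ • ∑ i : Fin n, T (X i ω) - ∫ x, T x ∂P‖} ≤ δ := by
  have hP : IsProbabilityMeasure P := by
    rw [← (hlaw 0).map_eq]; exact Measure.isProbabilityMeasure_map (hlaw 0).aemeasurable
  have hTk : ∀ k, Measurable fun x => T x k := fun k => (measurable_pi_apply k).comp hT
  have hL2 : ∀ k, MemLp (fun x => T x k) 2 P := fun k => by
    obtain ⟨K, hK⟩ := hbdd k
    exact MemLp.of_bound (hTk k).aestronglyMeasurable K (by simpa using hK)
  have hint : ∀ k, Integrable (fun x => T x k) P := fun k => (hL2 k).integrable (by norm_num)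
  set v : ι → ℝ := fun k => variance (fun x => T x k) P with hv
  have hv0 : ∀ k, 0 ≤ v k := fun k => variance_nonneg _ _
  have key : ∀ k, ∀ C : ℝ, 0 < C → ∀ n : ℕ, μ {ω | C < √(n : ℝ) *
      |(n : ℝ)⁻¹ * ∑ i : Fin n, T (X i ω) k - ∫ x, T x k ∂P|} ≤ ENNReal.ofReal (v k / C ^ 2) := by
    intro k C hC n
    have hl : ∀ i, HasLaw (fun ω => T (X i ω) k) (P.map fun x => T x k) μ := fun i =>
      HasLaw.comp ⟨(hTk k).aemeasurable, rfl⟩ (hlaw i)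
    refine measure_sqrt_mul_abs_mean_sub_le (X := fun i ω => T (X i ω) k) ?_ ?_ ?_ ?_ hC n
    · intro i
      have := hL2 k
      rw [← (hlaw i).map_eq] at this
      exact this.comp_of_map (hlaw i).aemeasurable
    · intro i
      exact (hlaw i).integral_comp (hTk k).aestronglyMeasurable
    · intro i
      rw [hv, ← (hlaw i).map_eq]
      exact (variance_map (hTk k).aemeasurable (hlaw i).aemeasurable).symm
    · exact hind.comp (fun _ x => T x k) fun _ => hTk k
  set V : ℝ := ∑ k, v k with hV
  have hVle : ∀ k, v k ≤ V := fun k => Finset.single_le_sum (fun j _ => hv0 j) (Finset.mem_univ k)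
  -- the union bound over the coordinates leaves `card ι * V / C²`, which vanishes as `C → ∞`
  have hlim : Tendsto (fun C : ℝ => ENNReal.ofReal (Fintype.card ι * (V / C ^ 2))) atTop (𝓝 0) := by
    rw [← ENNReal.ofReal_zero]
    refine ENNReal.tendsto_ofReal ?_
    have : Tendsto (fun C : ℝ => V / C ^ 2) atTop (𝓝 0) :=
      tendsto_const_nhds.div_atTop (tendsto_pow_atTop (by norm_num))
    simpa using this.const_mul (Fintype.card ι : ℝ)
  obtain ⟨C, hCδ, hC⟩ := ((hlim.eventually (ge_mem_nhds hδ)).and (eventually_gt_atTop 0)).exists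
  refine ⟨C, fun n => le_trans ?_ hCδ⟩
  calc μ {ω | C < √(n : ℝ) * ‖(n : ℝ)⁻¹ • ∑ i : Fin n, T (X i ω) - ∫ x, T x ∂P‖}
      ≤ μ (⋃ k ∈ (Finset.univ : Finset ι), {ω | C < √(n : ℝ) *
          |(n : ℝ)⁻¹ * ∑ i : Fin n, T (X i ω) k - ∫ x, T x k ∂P|}) := by
        refine measure_mono fun ω hω => ?_
        simp only [Set.mem_ofPred_eq, Set.mem_iUnion, Finset.mem_univ, exists_prop,
          true_and] at hω ⊢
        by_contra hcon
        push Not at hcon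
        refine hω.not_ge ?_
        rw [← Real.norm_of_nonneg (Real.sqrt_nonneg (n : ℝ)), ← norm_smul,
          pi_norm_le_iff_of_nonneg hC.le]
        intro k
        have := hcon k
        rw [Pi.smul_apply, norm_smul, Real.norm_of_nonneg (Real.sqrt_nonneg (n : ℝ)), Pi.sub_apply,
          Pi.smul_apply, Finset.sum_apply, eval_integral hint, Real.norm_eq_abs]
        exact this
    _ ≤ ∑ k, μ {ω | C < √(n : ℝ) *
          |(n : ℝ)⁻¹ * ∑ i : Fin n, T (X i ω) k - ∫ x, T x k ∂P|} := measure_biUnion_finset_le _ _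
    _ ≤ ∑ _k : ι, ENNReal.ofReal (V / C ^ 2) := by
        refine Finset.sum_le_sum fun k _ => (key k C hC n).trans (ENNReal.ofReal_le_ofReal ?_)
        gcongr
        exact hVle k
    _ = ENNReal.ofReal (Fintype.card ι * (V / C ^ 2)) := by
        rw [Finset.sum_const, Finset.card_univ, nsmul_eq_mul,
          ENNReal.ofReal_mul (Nat.cast_nonneg _), ENNReal.ofReal_natCast]

end Delta

/-! ### The statistics of a sample -/

section Stat

variable {S A Z : Type*} [DecidableEq S] [DecidableEq A] [DecidableEq Z]

/-- Index set of the sample statistics on which the estimator depends: the cells `(s, a, z)`, the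
instrument values `z`, and the pairs `(z, s')`. -/
abbrev StatIndex (S A Z : Type*) := (S × A × Z) ⊕ Z ⊕ (Z × S)

/-- The statistics of one sample: the cell indicators `𝟙{(sᵢ, aᵢ, zᵢ) = (s, a, z)}`, the rewards
`𝟙{zᵢ = z} rᵢ` and the transition indicators `𝟙{zᵢ = z, s'ᵢ = s'}`. -/
def stat (x : Sample S A Z) : StatIndex S A Z → ℝ
  | .inl y => gCount x y
  | .inr (.inl z) => if x.instr = z then x.reward else 0
  | .inr (.inr y) => if x.instr = y.1 ∧ x.next = y.2 then 1 else 0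

theorem stat_cell (x : Sample S A Z) (s : S) (a : A) (z : Z) :
    stat x (.inl (s, a, z)) = if x.1 = s ∧ x.2.1 = a ∧ x.2.2.1 = z then 1 else 0 :=
  rfl

theorem stat_reward (x : Sample S A Z) (z : Z) :
    stat x (.inr (.inl z)) = if x.2.2.1 = z then x.2.2.2.1 else 0 :=
  rfl

theorem stat_next (x : Sample S A Z) (z : Z) (s' : S) :
    stat x (.inr (.inr (z, s'))) = if x.2.2.1 = z ∧ x.2.2.2.2 = s' then 1 else 0 :=
  rfl

end Stat

/-! ### Moments of the offline data -/

section Moments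

theorem pmf_sum_toReal {α : Type*} [Fintype α] (p : PMF α) : ∑ a, (p a).toReal = 1 := by
  rw [← ENNReal.toReal_sum fun a _ => p.apply_ne_top a, ← tsum_fintype (L := .unconditional _),
    p.tsum_coe, ENNReal.toReal_one]

variable {S A Z : Type*} [Fintype S] [Fintype A] [Fintype Z]
  [DecidableEq S] [DecidableEq A] [DecidableEq Z]
  [MeasurableSpace S] [MeasurableSpace A] [MeasurableSpace Z]
  [DiscreteMeasurableSpace S] [DiscreteMeasurableSpace A] [DiscreteMeasurableSpace Z]

theorem Sampling.sum_rho (q : Sampling S A Z) (z : Z) :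
    ∑ s, ∑ a, (q.ρ z (s, a)).toReal = 1 := by
  rw [← Fintype.sum_prod_type (f := fun y : S × A => (q.ρ z y).toReal), pmf_sum_toReal]

theorem ConfoundedMDP.ae_abs_le_one (M : ConfoundedMDP S A) (s : S) (a : A) :
    ∀ᵐ e ∂(M.confLaw s a : Measure ℝ), |e| ≤ 1 := by
  filter_upwards [M.confLaw_mem s a] with e he
  exact abs_le.2 (M.E_subset he)

theorem ConfoundedMDP.integrable_conf (M : ConfoundedMDP S A) (s : S) (a : A) :
    Integrable (fun e : ℝ => e) (M.confLaw s a : Measure ℝ) :=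
  Integrable.of_bound measurable_id.aestronglyMeasurable 1
    (by simpa using M.ae_abs_le_one s a)

theorem ae_latentLaw_abs_conf_le_one (M : ConfoundedMDP S A) (q : Sampling S A Z) :
    ∀ᵐ x ∂(latentLaw M q), |Latent.conf x| ≤ 1 := by
  have hmeas : MeasurableSet {x : Latent S A Z | ¬ |Latent.conf x| ≤ 1} := by
    have : Measurable fun x : Latent S A Z => |Latent.conf x| := by
      unfold Latent.conf; fun_prop
    exact (measurableSet_le this measurable_const).compl
  rw [ae_iff, latentLaw]
  simp only [Measure.finsetSum_apply, Measure.smul_apply, smul_eq_mul]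
  refine Finset.sum_eq_zero fun z _ => Finset.sum_eq_zero fun s _ => Finset.sum_eq_zero fun a _ =>
    Finset.sum_eq_zero fun s' _ => ?_
  rw [Measure.map_apply (by fun_prop) hmeas]
  have := ae_iff.1 (M.ae_abs_le_one s a)
  simp only [Set.preimage_ofPred_eq]
  rw [this, mul_zero]

theorem integral_latentLaw (M : ConfoundedMDP S A) (q : Sampling S A Z) {f : Latent S A Z → ℝ}
    (hf : Measurable f)
    (hint : ∀ s a z s', Integrable (fun e => f (s, a, z, e, s')) (M.confLaw s a : Measure ℝ)) :
    ∫ x, f x ∂(latentLaw M q) = ∑ z, ∑ s, ∑ a, ∑ s',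
      (q.p z).toReal * (q.ρ z (s, a)).toReal * (M.P s a s').toReal *
        ∫ e, f (s, a, z, e, s') ∂(M.confLaw s a : Measure ℝ) := by
  have hmap : ∀ s a z s', Integrable f ((q.p z * q.ρ z (s, a) * M.P s a s') •
      (M.confLaw s a : Measure ℝ).map (fun e => ((s, a, z, e, s') : Latent S A Z))) := by
    intro s a z s'
    refine Integrable.smul_measure ?_ (ENNReal.mul_ne_top (ENNReal.mul_ne_top
      (q.p.apply_ne_top z) ((q.ρ z).apply_ne_top _)) ((M.P s a).apply_ne_top _))
    exact (integrable_map_measure hf.aestronglyMeasurable (by fun_prop)).2 (hint s a z s')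
  rw [latentLaw, integral_finsetSum_measure fun z _ => integrable_finsetSum_measure.2
    fun s _ => integrable_finsetSum_measure.2 fun a _ => integrable_finsetSum_measure.2
    fun s' _ => hmap s a z s']
  refine Finset.sum_congr rfl fun z _ => ?_
  rw [integral_finsetSum_measure fun s _ => integrable_finsetSum_measure.2 fun a _ =>
    integrable_finsetSum_measure.2 fun s' _ => hmap s a z s']
  refine Finset.sum_congr rfl fun s _ => ?_
  rw [integral_finsetSum_measure fun a _ =>
    integrable_finsetSum_measure.2 fun s' _ => hmap s a z s']
  refine Finset.sum_congr rfl fun a _ => ?_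
  rw [integral_finsetSum_measure fun s' _ => hmap s a z s']
  refine Finset.sum_congr rfl fun s' _ => ?_
  rw [integral_smul_measure, integral_map (by fun_prop) hf.aestronglyMeasurable, smul_eq_mul,
    ENNReal.toReal_mul, ENNReal.toReal_mul]

theorem measurable_observe (M : ConfoundedMDP S A) :
    Measurable (observe M : Latent S A Z → Sample S A Z) := by
  have : Measurable fun x : Latent S A Z => M.R x.1 x.2.1 :=
    (Measurable.of_discrete (f := fun y : S × A => M.R y.1 y.2)).comp
      (f := fun x : Latent S A Z => (x.1, x.2.1)) (by fun_prop)
  unfold observe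
  fun_prop

instance sampleLaw_isProbabilityMeasure (M : ConfoundedMDP S A) (q : Sampling S A Z) :
    IsProbabilityMeasure (sampleLaw M q) :=
  Measure.isProbabilityMeasure_map (measurable_observe M).aemeasurable

theorem measurable_stat : Measurable (stat (S := S) (A := A) (Z := Z)) := by
  have h1 : ∀ s : S, MeasurableSet {x : Sample S A Z | x.1 = s} := fun s =>
    measurableSet_eq_fun (by fun_prop) measurable_const
  have h2 : ∀ a : A, MeasurableSet {x : Sample S A Z | x.2.1 = a} := fun s =>
    measurableSet_eq_fun (by fun_prop) measurable_const
  have h3 : ∀ z : Z, MeasurableSet {x : Sample S A Z | x.2.2.1 = z} := fun s =>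
    measurableSet_eq_fun (by fun_prop) measurable_const
  have h5 : ∀ s : S, MeasurableSet {x : Sample S A Z | x.2.2.2.2 = s} := fun s =>
    measurableSet_eq_fun (by fun_prop) measurable_const
  refine measurable_pi_iff.2 ?_
  rintro (⟨s, a, z⟩ | z | ⟨z, s'⟩)
  · exact Measurable.ite ((h1 s).inter ((h2 a).inter (h3 z))) measurable_const measurable_const
  · exact Measurable.ite (h3 z) (by fun_prop) measurable_const
  · exact Measurable.ite ((h3 z).inter (h5 s')) measurable_const measurable_const

theorem measurable_stat_apply (k : StatIndex S A Z) :
    Measurable fun x : Sample S A Z => stat x k :=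
  (measurable_pi_apply k).comp measurable_stat

theorem ae_abs_stat_le (M : ConfoundedMDP S A) (q : Sampling S A Z) (k : StatIndex S A Z) :
    ∃ K : ℝ, ∀ᵐ x ∂(sampleLaw M q), |stat x k| ≤ K := by
  refine ⟨∑ s, ∑ a, |M.R s a| + 1, ?_⟩
  have hR : ∀ s a, |M.R s a| ≤ ∑ s, ∑ a, |M.R s a| := fun s a =>
    (Finset.single_le_sum (f := fun a => |M.R s a|) (fun _ _ => abs_nonneg _)
      (Finset.mem_univ a)).trans
    (Finset.single_le_sum (f := fun s => ∑ a, |M.R s a|)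
      (fun _ _ => Finset.sum_nonneg fun _ _ => abs_nonneg _) (Finset.mem_univ s))
  have h0 : 0 ≤ ∑ s, ∑ a, |M.R s a| :=
    Finset.sum_nonneg fun _ _ => Finset.sum_nonneg fun _ _ => abs_nonneg _
  rw [sampleLaw, ae_map_iff (measurable_observe M).aemeasurable
    (measurableSet_le (measurable_stat_apply k).abs measurable_const)]
  filter_upwards [ae_latentLaw_abs_conf_le_one M q] with x hx
  rcases k with ⟨s, a, z⟩ | z | ⟨z, s'⟩
  · simp only [stat_cell]
    split_ifs <;> simp <;> linarith
  · simp only [stat_reward, observe]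
    split_ifs
    · exact (abs_add_le _ _).trans (add_le_add (hR _ _) hx)
    · simp; linarith
  · simp only [stat_next]
    split_ifs <;> simp <;> linarith

theorem integrable_stat_apply (M : ConfoundedMDP S A) (q : Sampling S A Z) (k : StatIndex S A Z) :
    Integrable (fun x => stat x k) (sampleLaw M q) := by
  obtain ⟨K, hK⟩ := ae_abs_stat_le M q k
  exact Integrable.of_bound (measurable_stat_apply k).aestronglyMeasurable K
    (by simpa using hK)

theorem integrable_stat (M : ConfoundedMDP S A) (q : Sampling S A Z) :
    Integrable stat (sampleLaw M q) :=
  Integrable.of_eval (integrable_stat_apply M q)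

/-- The population mean of the sample statistics. -/
def meanStat (M : ConfoundedMDP S A) (q : Sampling S A Z) : StatIndex S A Z → ℝ :=
  ∫ x, stat x ∂(sampleLaw M q)

theorem meanStat_apply (M : ConfoundedMDP S A) (q : Sampling S A Z) (k : StatIndex S A Z) :
    meanStat M q k = ∫ x, stat x k ∂(sampleLaw M q) :=
  eval_integral (integrable_stat_apply M q) k

/-- In an instrumental variable model the confounder averages to zero at each value of the
instrument. -/
theorem InstrumentalVariable.sum_rho_mul_mean_conf {M : ConfoundedMDP S A} {q : Sampling S A Z}
    (hiv : InstrumentalVariable M q) (hp : ∀ z, q.p z ≠ 0) (z : Z) :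
    ∑ s, ∑ a, (q.ρ z (s, a)).toReal * ∫ e, e ∂(M.confLaw s a : Measure ℝ) = 0 := by
  have hz : MeasurableSet {x : Latent S A Z | x.2.2.1 = z} :=
    measurableSet_eq_fun (by fun_prop) measurable_const
  have hconf : Measurable (Latent.conf (S := S) (A := A) (Z := Z)) := by
    unfold Latent.conf; fun_prop
  have hint : Integrable (Latent.conf (S := S) (A := A) (Z := Z)) (latentLaw M q) :=
    Integrable.of_bound hconf.aestronglyMeasurable 1
      (by simpa using ae_latentLaw_abs_conf_le_one M q)
  have hm : MeasurableSpace.comap (Latent.instr (S := S) (A := A) (Z := Z)) inferInstance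
      ≤ (inferInstance : MeasurableSpace (Latent S A Z)) :=
    Measurable.comap_le (by unfold Latent.instr; fun_prop)
  have h1 := setIntegral_condExp hm hint (s := {x : Latent S A Z | x.2.2.1 = z})
    ⟨{z}, measurableSet_singleton z, rfl⟩
  have h2 : ∫ x in {x : Latent S A Z | x.2.2.1 = z}, ((latentLaw M q)[Latent.conf |
      MeasurableSpace.comap (Latent.instr (S := S) (A := A) (Z := Z)) inferInstance]) x
      ∂(latentLaw M q) = 0 := by
    rw [integral_congr_ae (ae_restrict_of_ae hiv.condMean)]
    simp
  rw [h2, ← integral_indicator hz, integral_latentLaw M q (hconf.indicator hz)] at h1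
  · have h3 : ∀ (s : S) (a : A) (z' : Z) (s' : S), ∫ e,
        ({x : Latent S A Z | x.2.2.1 = z}.indicator Latent.conf) (s, a, z', e, s')
          ∂(M.confLaw s a : Measure ℝ) =
        if z' = z then ∫ e, e ∂(M.confLaw s a : Measure ℝ) else 0 := by
      intro s a z' s'
      by_cases h : z' = z <;> simp [Set.indicator, h, Latent.conf]
    simp only [h3, mul_ite, mul_zero, Finset.sum_ite_irrel, Finset.sum_const_zero,
      Finset.sum_ite_eq', Finset.mem_univ, if_true] at h1
    have hz0 : (q.p z).toReal ≠ 0 := ENNReal.toReal_ne_zero.2 ⟨hp z, q.p.apply_ne_top z⟩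
    have h4 : (q.p z).toReal *
        ∑ s, ∑ a, (q.ρ z (s, a)).toReal * ∫ e, e ∂(M.confLaw s a : Measure ℝ) = 0 := by
      rw [h1, Finset.mul_sum]
      refine Finset.sum_congr rfl fun s _ => ?_
      rw [Finset.mul_sum]
      refine Finset.sum_congr rfl fun a _ => ?_
      rw [← Finset.sum_mul, ← Finset.mul_sum, pmf_sum_toReal]
      ring
    exact (mul_eq_zero.1 h4).resolve_left hz0
  · intro s a z' s'
    by_cases h : z' = z
    · simpa [Set.indicator, h, Latent.conf] using M.integrable_conf s a
    · simp [Set.indicator, h]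

theorem integral_sampleLaw (M : ConfoundedMDP S A) (q : Sampling S A Z) {f : Sample S A Z → ℝ}
    (hf : Measurable f) (hint : ∀ s a z s',
      Integrable (fun e => f (s, a, z, M.R s a + e, s')) (M.confLaw s a : Measure ℝ)) :
    ∫ x, f x ∂(sampleLaw M q) = ∑ z, ∑ s, ∑ a, ∑ s',
      (q.p z).toReal * (q.ρ z (s, a)).toReal * (M.P s a s').toReal *
        ∫ e, f (s, a, z, M.R s a + e, s') ∂(M.confLaw s a : Measure ℝ) := by
  rw [sampleLaw, integral_map (measurable_observe M).aemeasurable hf.aestronglyMeasurable]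
  exact integral_latentLaw M q (hf.comp (measurable_observe M)) hint

theorem meanStat_count (M : ConfoundedMDP S A) (q : Sampling S A Z) (s : S) (a : A) (z : Z) :
    meanStat M q (.inl (s, a, z)) = (q.p z).toReal * (q.ρ z (s, a)).toReal := by
  rw [meanStat_apply, integral_sampleLaw M q (measurable_stat_apply _)]
  · have h3 : ∀ (s₁ : S) (a₁ : A) (z₁ : Z) (s' : S), ∫ e,
        stat ((s₁, a₁, z₁, M.R s₁ a₁ + e, s') : Sample S A Z) (.inl (s, a, z))
          ∂(M.confLaw s₁ a₁ : Measure ℝ) =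
        if z₁ = z then if s₁ = s then if a₁ = a then 1 else 0 else 0 else 0 := by
      intro s₁ a₁ z₁ s'
      change ∫ _, (if s₁ = s ∧ a₁ = a ∧ z₁ = z then (1 : ℝ) else 0)
        ∂(M.confLaw s₁ a₁ : Measure ℝ) = _
      by_cases h₁ : s₁ = s <;> by_cases h₂ : a₁ = a <;> by_cases h₃ : z₁ = z <;>
        simp [h₁, h₂, h₃]
    simp only [h3, mul_ite, mul_one, mul_zero, Finset.sum_ite_irrel, Finset.sum_const_zero,
      Finset.sum_ite_eq', Finset.mem_univ, if_true, ← Finset.mul_sum, pmf_sum_toReal]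
  · intro s' a' z' s''
    change Integrable (fun _ => if s' = s ∧ a' = a ∧ z' = z then (1 : ℝ) else 0) _
    exact integrable_const _

theorem meanStat_reward {M : ConfoundedMDP S A} {q : Sampling S A Z}
    (hiv : InstrumentalVariable M q) (hp : ∀ z, q.p z ≠ 0) (z : Z) :
    meanStat M q (.inr (.inl z)) =
      (q.p z).toReal * ∑ s, ∑ a, (q.ρ z (s, a)).toReal * M.R s a := by
  have hI : ∀ s a, Integrable (fun e => M.R s a + e) (M.confLaw s a : Measure ℝ) := fun s a =>
    (integrable_const _).add (M.integrable_conf s a)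
  have hE : ∀ s a, ∫ e, (M.R s a + e) ∂(M.confLaw s a : Measure ℝ) =
      M.R s a + ∫ e, e ∂(M.confLaw s a : Measure ℝ) := fun s a => by
    rw [integral_add (integrable_const _) (M.integrable_conf s a)]
    simp
  rw [meanStat_apply, integral_sampleLaw M q (measurable_stat_apply _)]
  · have h3 : ∀ (s : S) (a : A) (z' : Z) (s' : S), ∫ e,
        stat ((s, a, z', M.R s a + e, s') : Sample S A Z) (.inr (.inl z))
          ∂(M.confLaw s a : Measure ℝ) =
        if z' = z then M.R s a + ∫ e, e ∂(M.confLaw s a : Measure ℝ) else 0 := by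
      intro s a z' s'
      by_cases h : z' = z <;> simp [stat_reward, h, hE]
    simp only [h3, mul_ite, mul_zero, Finset.sum_ite_irrel, Finset.sum_const_zero,
      Finset.sum_ite_eq', Finset.mem_univ, if_true, ← Finset.sum_mul, ← Finset.mul_sum,
      pmf_sum_toReal, mul_one]
    have h0 := hiv.sum_rho_mul_mean_conf hp z
    calc ∑ s, ∑ a, (q.p z).toReal * (q.ρ z (s, a)).toReal *
          (M.R s a + ∫ e, e ∂(M.confLaw s a : Measure ℝ))
        = (q.p z).toReal * (∑ s, ∑ a, (q.ρ z (s, a)).toReal * M.R s a) + (q.p z).toReal *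
          (∑ s, ∑ a, (q.ρ z (s, a)).toReal * ∫ e, e ∂(M.confLaw s a : Measure ℝ)) := by
          simp only [Finset.mul_sum, ← Finset.sum_add_distrib]
          refine Finset.sum_congr rfl fun s _ => Finset.sum_congr rfl fun a _ => ?_
          ring
      _ = _ := by rw [h0]; ring
  · intro s a z' s'
    by_cases h : z' = z
    · simpa only [stat_reward, h, if_true] using hI s a
    · simp [stat_reward, h]

theorem meanStat_next (M : ConfoundedMDP S A) (q : Sampling S A Z) (z : Z) (s' : S) :
    meanStat M q (.inr (.inr (z, s'))) =
      (q.p z).toReal * ∑ s, ∑ a, (q.ρ z (s, a)).toReal * (M.P s a s').toReal := by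
  rw [meanStat_apply, integral_sampleLaw M q (measurable_stat_apply _)]
  · have h3 : ∀ (s₁ : S) (a₁ : A) (z₁ : Z) (s₂ : S), ∫ e,
        stat ((s₁, a₁, z₁, M.R s₁ a₁ + e, s₂) : Sample S A Z) (.inr (.inr (z, s')))
          ∂(M.confLaw s₁ a₁ : Measure ℝ) =
        if z₁ = z then if s₂ = s' then 1 else 0 else 0 := by
      intro s₁ a₁ z₁ s₂
      change ∫ _, (if z₁ = z ∧ s₂ = s' then (1 : ℝ) else 0) ∂(M.confLaw s₁ a₁ : Measure ℝ) = _
      by_cases h₁ : z₁ = z <;> by_cases h₂ : s₂ = s' <;> simp [h₁, h₂]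
    simp only [h3, mul_ite, mul_one, mul_zero, Finset.sum_ite_irrel, Finset.sum_const_zero,
      Finset.sum_ite_eq', Finset.mem_univ, if_true, mul_assoc, Finset.mul_sum]
  · intro s₁ a₁ z₁ s₂
    change Integrable (fun _ => if z₁ = z ∧ s₂ = s' then (1 : ℝ) else 0) _
    exact integrable_const _

end Moments

/-! ### The value function and its Bellman equation -/

section ValueFunction

/-- A discounted averaging operator has no nonzero fixed point: look at a state where `|u|` is
maximal. -/
theorem eq_zero_of_eq_discounted_average {S : Type*} [Fintype S] {Q : S → S → ℝ}
    (hQ : ∀ s s', 0 ≤ Q s s') (hQ1 : ∀ s, ∑ s', Q s s' = 1) {γ : ℝ} (h0 : 0 ≤ γ) (h1 : γ < 1)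
    {u : S → ℝ} (hu : ∀ s, u s = γ * ∑ s', Q s s' * u s') : u = 0 := by
  have key : ∀ s, |u s| ≤ γ * ‖u‖ := by
    intro s
    rw [hu s, abs_mul, abs_of_nonneg h0]
    refine mul_le_mul_of_nonneg_left ?_ h0
    calc |∑ s', Q s s' * u s'| ≤ ∑ s', |Q s s' * u s'| := Finset.abs_sum_le_sum_abs _ _
      _ ≤ ∑ s', Q s s' * ‖u‖ := by
        refine Finset.sum_le_sum fun s' _ => ?_
        rw [abs_mul, abs_of_nonneg (hQ s s')]
        exact mul_le_mul_of_nonneg_left (norm_le_pi_norm u s') (hQ s s')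
      _ = ‖u‖ := by rw [← Finset.sum_mul, hQ1, one_mul]
  have hle : ‖u‖ ≤ γ * ‖u‖ :=
    (pi_norm_le_iff_of_nonneg (mul_nonneg h0 (norm_nonneg _))).2 key
  have : ‖u‖ = 0 := by nlinarith [norm_nonneg u]
  exact norm_eq_zero.1 this

variable {S A : Type*} [Fintype S] [Fintype A] [MeasurableSpace S] [MeasurableSpace A]

theorem integral_stepLaw (π : S → PMF A) (P₀ : ProbabilityMeasure ℝ) (μ : PMF S)
    {g : S × A × ℝ → ℝ} (hg : Measurable g)
    (hint : ∀ s a, Integrable (fun e => g (s, a, e)) (P₀ : Measure ℝ)) :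
    ∫ x, g x ∂(stepLaw π P₀ μ) = ∑ s, ∑ a, (μ s).toReal * (π s a).toReal *
      ∫ e, g (s, a, e) ∂(P₀ : Measure ℝ) := by
  have hmap : ∀ s a, Integrable g ((μ s * π s a) •
      (P₀ : Measure ℝ).map (fun e => ((s, a, e) : S × A × ℝ))) := by
    intro s a
    refine Integrable.smul_measure ?_ (ENNReal.mul_ne_top (μ.apply_ne_top s)
      ((π s).apply_ne_top a))
    exact (integrable_map_measure hg.aestronglyMeasurable (by fun_prop)).2 (hint s a)
  rw [stepLaw, integral_finsetSum_measure fun s _ => integrable_finsetSum_measure.2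
    fun a _ => hmap s a]
  refine Finset.sum_congr rfl fun s _ => ?_
  rw [integral_finsetSum_measure fun a _ => hmap s a]
  refine Finset.sum_congr rfl fun a _ => ?_
  rw [integral_smul_measure, integral_map (φ := fun e => (s, a, e)) (by fun_prop)
    hg.aestronglyMeasurable, smul_eq_mul,
    ENNReal.toReal_mul]

theorem stepLaw_abs_conf_gt_one (M : ConfoundedMDP S A) (π : S → PMF A)
    {P₀ : ProbabilityMeasure ℝ} (hP₀ : ∀ᵐ e ∂(P₀ : Measure ℝ), e ∈ M.E) (μ : PMF S) :
    stepLaw π P₀ μ {x | ¬ |x.2.2| ≤ 1} = 0 := by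
  have hmeas : MeasurableSet {x : S × A × ℝ | ¬ |x.2.2| ≤ 1} :=
    (measurableSet_le (f := fun x : S × A × ℝ => |x.2.2|) (by fun_prop) measurable_const).compl
  rw [stepLaw]
  simp only [Measure.finsetSum_apply, Measure.smul_apply, smul_eq_mul]
  refine Finset.sum_eq_zero fun s _ => Finset.sum_eq_zero fun a _ => ?_
  rw [Measure.map_apply (by fun_prop) hmeas]
  have : ∀ᵐ e ∂(P₀ : Measure ℝ), |e| ≤ 1 := by
    filter_upwards [hP₀] with e he
    exact abs_le.2 (M.E_subset he)
  have := ae_iff.1 this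
  simp only [Set.preimage_ofPred_eq]
  rw [this, mul_zero]

variable [DiscreteMeasurableSpace S] [DiscreteMeasurableSpace A]

instance trajectoryLaw_isProbabilityMeasure (M : ConfoundedMDP S A) (π : S → PMF A)
    (P₀ : ProbabilityMeasure ℝ) (s₀ : S) : IsProbabilityMeasure (trajectoryLaw M π P₀ s₀) := by
  unfold trajectoryLaw; infer_instance

theorem trajectoryLaw_map_zero (M : ConfoundedMDP S A) (π : S → PMF A)
    (P₀ : ProbabilityMeasure ℝ) (s₀ : S) :
    (trajectoryLaw M π P₀ s₀).map (fun x => x 0) = stepLaw π P₀ (PMF.pure s₀) := by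
  have hf : (fun x : ℕ → S × A × ℝ => x 0) =
      (fun h : (i : Finset.Iic 0) → S × A × ℝ => h ⟨0, Finset.mem_Iic.2 le_rfl⟩) ∘
        Preorder.frestrictLe 0 := rfl
  have hm : Measurable fun h : (i : Finset.Iic 0) → S × A × ℝ =>
    h ⟨0, Finset.mem_Iic.2 le_rfl⟩ := measurable_pi_apply _
  rw [hf, ← Measure.map_map hm (Preorder.measurable_frestrictLe 0),
    trajectoryLaw, Kernel.trajMeasure, Measure.map_comp _ _ (Preorder.measurable_frestrictLe 0),
    Kernel.traj_map_frestrictLe, Kernel.partialTraj_self, Measure.id_comp,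
    Measure.map_map hm (MeasurableEquiv.measurable _)]
  exact Measure.map_id

theorem trajectoryLaw_map_succ (M : ConfoundedMDP S A) (π : S → PMF A)
    (P₀ : ProbabilityMeasure ℝ) (s₀ : S) (n : ℕ) :
    (trajectoryLaw M π P₀ s₀).map (fun x => x (n + 1)) =
      stepKernel M π P₀ ∘ₘ (trajectoryLaw M π P₀ s₀).map (fun x => x n) := by
  have hm : Measurable fun h : (i : Finset.Iic n) → S × A × ℝ =>
    h ⟨n, Finset.mem_Iic.2 le_rfl⟩ := measurable_pi_apply _
  have hf : (fun x : ℕ → S × A × ℝ => x n) =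
      (fun h : (i : Finset.Iic n) → S × A × ℝ => h ⟨n, Finset.mem_Iic.2 le_rfl⟩) ∘
        Preorder.frestrictLe n := rfl
  have hjoint := congrArg Measure.snd
    (Kernel.map_frestrictLe_trajMeasure_compProd_eq_map_trajMeasure
    (X := fun _ => S × A × ℝ) (μ₀ := stepLaw π P₀ (PMF.pure s₀))
    (κ := fun n => (stepKernel M π P₀).comap
      (fun h : (i : Finset.Iic n) → S × A × ℝ => h ⟨n, Finset.mem_Iic.2 le_rfl⟩)
      (measurable_pi_apply _)) (a := n))
  have hcomap : (stepKernel M π P₀).comap _ hm =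
      stepKernel M π P₀ ∘ₖ Kernel.deterministic _ hm :=
    (Kernel.comp_deterministic_eq_comap _ hm).symm
  rw [Measure.snd_compProd, Measure.snd_map_prodMk (Preorder.measurable_frestrictLe n), hcomap,
    ← Measure.comp_assoc, Measure.deterministic_comp_eq_map,
    Measure.map_map hm (Preorder.measurable_frestrictLe n), ← hf] at hjoint
  exact hjoint.symm

/-- The confounders along a trajectory are almost surely bounded by one. -/
theorem ae_trajectoryLaw_abs_conf_le_one (M : ConfoundedMDP S A) (π : S → PMF A)
    {P₀ : ProbabilityMeasure ℝ} (hP₀ : ∀ᵐ e ∂(P₀ : Measure ℝ), e ∈ M.E) (s₀ : S) (n : ℕ) :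
    ∀ᵐ x ∂(trajectoryLaw M π P₀ s₀), |(x n).2.2| ≤ 1 := by
  have hmeas : MeasurableSet {x : S × A × ℝ | |x.2.2| ≤ 1} :=
    measurableSet_le (by fun_prop) measurable_const
  suffices h : ∀ᵐ y ∂((trajectoryLaw M π P₀ s₀).map fun x => x n), |y.2.2| ≤ 1 from
    (ae_map_iff (measurable_pi_apply n).aemeasurable hmeas).1 h
  cases n with
  | zero => rw [trajectoryLaw_map_zero]; exact stepLaw_abs_conf_gt_one M π hP₀ _
  | succ n =>
    rw [trajectoryLaw_map_succ]
    exact Measure.ae_comp_of_ae_ae hmeas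
      (Eventually.of_forall fun y => stepLaw_abs_conf_gt_one M π hP₀ _)

theorem integral_trajectoryLaw_succ (M : ConfoundedMDP S A) (π : S → PMF A)
    (P₀ : ProbabilityMeasure ℝ) (s₀ : S) (n : ℕ) {g : S × A × ℝ → ℝ} (hg : Measurable g)
    (hint : Integrable (fun x => g (x (n + 1))) (trajectoryLaw M π P₀ s₀)) :
    ∫ x, g (x (n + 1)) ∂(trajectoryLaw M π P₀ s₀) =
      ∫ x, ∫ y, g y ∂(stepLaw π P₀ (M.P (x n).1 (x n).2.1)) ∂(trajectoryLaw M π P₀ s₀) := by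
  have hint' : Integrable g ((trajectoryLaw M π P₀ s₀).map fun x => x (n + 1)) :=
    (integrable_map_measure hg.aestronglyMeasurable
      (measurable_pi_apply _).aemeasurable).2 hint
  rw [← integral_map (φ := fun x : ℕ → S × A × ℝ => x (n + 1)) (measurable_pi_apply _).aemeasurable
    hg.aestronglyMeasurable]
  rw [trajectoryLaw_map_succ] at hint' ⊢
  rw [Measure.comp_eq_comp_const_apply] at hint' ⊢
  rw [Kernel.integral_comp hint', Kernel.const_apply,
    integral_map (measurable_pi_apply _).aemeasurable]
  · rfl
  · exact (hg.stronglyMeasurable.integral_kernel (κ := stepKernel M π P₀)).aestronglyMeasurable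

/-- A solution of the Bellman equation of the target policy is its value function: the
discounted expected rewards telescope. -/
theorem value_eq_of_bellman (M : ConfoundedMDP S A) (π : S → PMF A) {P₀ : ProbabilityMeasure ℝ}
    (hP₀ : ∀ᵐ e ∂(P₀ : Measure ℝ), e ∈ M.E) (hmean : ∫ e, e ∂(P₀ : Measure ℝ) = 0) {U : S → ℝ}
    (hU : ∀ s, U s = ∑ a, (π s a).toReal *
      (M.R s a + M.γ * ∑ s', (M.P s a s').toReal * U s')) :
    value M π P₀ = U := by
  funext s₀
  set T := trajectoryLaw M π P₀ s₀ with hT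
  have hd : ∀ f : S → A → ℝ, Measurable fun y : S × A × ℝ => f y.1 y.2.1 := fun f =>
    (Measurable.of_discrete (f := fun y : S × A => f y.1 y.2)).comp
      (f := fun x : S × A × ℝ => (x.1, x.2.1)) (by fun_prop)
  have hbd : ∀ f : S → A → ℝ, ∀ s a, |f s a| ≤ ∑ s, ∑ a, |f s a| := fun f s a =>
    (Finset.single_le_sum (f := fun a => |f s a|) (fun _ _ => abs_nonneg _)
      (Finset.mem_univ a)).trans
    (Finset.single_le_sum (f := fun s => ∑ a, |f s a|)
      (fun _ _ => Finset.sum_nonneg fun _ _ => abs_nonneg _) (Finset.mem_univ s))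
  have hdT : ∀ (f : S → A → ℝ) t, Integrable (fun x => f (x t).1 (x t).2.1) T := fun f t =>
    Integrable.of_bound ((hd f).comp (g := fun y : S × A × ℝ => f y.1 y.2.1)
      (measurable_pi_apply t)).aestronglyMeasurable _
      (Eventually.of_forall fun x => hbd f _ _)
  have hεT : ∀ t, Integrable (fun x => (x t).2.2) T := fun t =>
    Integrable.of_bound (Measurable.aestronglyMeasurable (by fun_prop)) 1
      (by simpa using ae_trajectoryLaw_abs_conf_le_one M π hP₀ s₀ t)
  have hε₀ : Integrable (fun e : ℝ => e) (P₀ : Measure ℝ) :=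
    Integrable.of_bound measurable_id.aestronglyMeasurable 1 (by
      filter_upwards [hP₀] with e he
      exact abs_le.2 (M.E_subset he))
  -- the Bellman residual of a step has mean zero, whatever the law of the state
  set N : S → A → ℝ := fun s a => ∑ s', (M.P s a s').toReal * U s' with hN
  set f : S → A → ℝ := fun s a => M.R s a + M.γ * N s a - U s with hf
  set G : S × A × ℝ → ℝ := fun y => f y.1 y.2.1 + y.2.2 with hG
  have hGm : Measurable G := (hd f).add (by fun_prop)
  have hG0 : ∀ m : PMF S, ∫ y, G y ∂(stepLaw π P₀ m) = 0 := by
    intro m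
    rw [integral_stepLaw π P₀ m hGm fun s a => (integrable_const (f s a)).add hε₀]
    have : ∀ s a, ∫ e, G (s, a, e) ∂(P₀ : Measure ℝ) = f s a := by
      intro s a
      simp only [hG]
      rw [integral_add (integrable_const _) hε₀, hmean]
      simp
    simp only [this, mul_assoc, ← Finset.mul_sum]
    refine Finset.sum_eq_zero fun s _ => ?_
    have h0 : ∑ a, (π s a).toReal * f s a = 0 := by
      simp only [hf, mul_sub, Finset.sum_sub_distrib, ← Finset.sum_mul, pmf_sum_toReal, one_mul]
      rw [hU s, sub_self]
    rw [h0, mul_zero]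
  have hGT : ∀ t, Integrable (fun x => G (x t)) T := fun t => (hdT f t).add (hεT t)
  have hres : ∀ t, ∫ x, G (x t) ∂T = 0 := by
    intro t
    cases t with
    | zero =>
      rw [← integral_map (φ := fun x : ℕ → S × A × ℝ => x 0) (measurable_pi_apply _).aemeasurable
        hGm.aestronglyMeasurable, hT, trajectoryLaw_map_zero]
      exact hG0 _
    | succ t =>
      rw [hT, integral_trajectoryLaw_succ M π P₀ s₀ t hGm (hGT _)]
      simp [hG0]
  have hnext : ∀ t, ∫ x, U (x (t + 1)).1 ∂T = ∫ x, N (x t).1 (x t).2.1 ∂T := by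
    intro t
    rw [hT, integral_trajectoryLaw_succ M π P₀ s₀ t (g := fun y => U y.1) (hd fun s _ => U s)
      (hdT (fun s _ => U s) _)]
    refine integral_congr_ae (Eventually.of_forall fun x => ?_)
    simp only
    rw [integral_stepLaw π P₀ _ (hd fun s _ => U s) fun s _ => integrable_const (U s)]
    simp only [integral_const, probReal_univ, one_smul, hN]
    refine Finset.sum_congr rfl fun s _ => ?_
    rw [← Finset.sum_mul, ← Finset.mul_sum, pmf_sum_toReal, mul_one]
  set b : ℕ → ℝ := fun t => M.γ ^ t * ∫ x, U (x t).1 ∂T with hb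
  set F : ℕ → (ℕ → S × A × ℝ) → ℝ :=
    fun t x => M.γ ^ t * (M.R (x t).1 (x t).2.1 + (x t).2.2) with hF
  have hrT : ∀ t, Integrable (fun x => M.R (x t).1 (x t).2.1 + (x t).2.2) T := fun t =>
    (hdT M.R t).add (hεT t)
  have hγN : ∀ t, Integrable (fun x => M.γ * N (x t).1 (x t).2.1) T := fun t =>
    (hdT N t).const_mul _
  have hFint : ∀ t, ∫ x, F t x ∂T = b t - b (t + 1) := by
    intro t
    have h1 : ∫ x, (M.R (x t).1 (x t).2.1 + (x t).2.2) ∂T =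
        ∫ x, U (x t).1 ∂T - M.γ * ∫ x, U (x (t + 1)).1 ∂T := by
      have hrN : Integrable (fun x => M.R (x t).1 (x t).2.1 + (x t).2.2 +
        M.γ * N (x t).1 (x t).2.1) T := (hrT t).add (hγN t)
      have h2 := hres t
      have h3 : ∀ x : ℕ → S × A × ℝ, G (x t) = (M.R (x t).1 (x t).2.1 + (x t).2.2) +
          M.γ * N (x t).1 (x t).2.1 - U (x t).1 := fun x => by simp only [hG, hf]; ring
      simp only [h3] at h2
      rw [integral_sub hrN (hdT (fun s _ => U s) t),
        integral_add (hrT t) (hγN t), integral_const_mul, ← hnext] at h2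
      linarith
    simp only [hF, hb]
    rw [integral_const_mul, h1, pow_succ]
    ring
  have hsum : Summable fun t => ∫ x, ‖F t x‖ ∂T := by
    refine Summable.of_nonneg_of_le (fun t => integral_nonneg fun x => norm_nonneg _) (fun t => ?_)
      ((summable_geometric_of_lt_one M.γ_nonneg M.γ_lt_one).mul_right
        (∑ s, ∑ a, |M.R s a| + 1))
    calc ∫ x, ‖F t x‖ ∂T ≤ ∫ _, M.γ ^ t * (∑ s, ∑ a, |M.R s a| + 1) ∂T := by
          refine integral_mono_ae ((hrT t).const_mul _).norm (integrable_const _) ?_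
          filter_upwards [ae_trajectoryLaw_abs_conf_le_one M π hP₀ s₀ t] with x hx
          simp only [hF]
          rw [norm_mul, Real.norm_of_nonneg (pow_nonneg M.γ_nonneg t)]
          exact mul_le_mul_of_nonneg_left
            ((abs_add_le _ _).trans (add_le_add (hbd M.R _ _) hx)) (pow_nonneg M.γ_nonneg t)
      _ = _ := by simp
  have hHas := hasSum_integral_of_summable_integral_norm (fun t => (hrT t).const_mul (M.γ ^ t))
    hsum
  have hb0 : b 0 = U s₀ := by
    simp only [hb, pow_zero, one_mul]
    rw [← integral_map (φ := fun x : ℕ → S × A × ℝ => x 0) (f := fun y => U y.1)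
      (measurable_pi_apply _).aemeasurable
      (hd fun s _ => U s).aestronglyMeasurable, hT, trajectoryLaw_map_zero,
      integral_stepLaw π P₀ _ (hd fun s _ => U s) fun s _ => integrable_const (U s)]
    simp only [integral_const, probReal_univ, one_smul, mul_assoc, ← Finset.mul_sum,
      ← Finset.sum_mul, pmf_sum_toReal, one_mul, PMF.pure_apply]
    classical
    rw [Finset.sum_eq_single s₀] <;> simp +contextual
  have hblim : Tendsto b atTop (𝓝 0) := by
    have hg := tendsto_pow_atTop_nhds_zero_of_lt_one M.γ_nonneg M.γ_lt_one
    refine squeeze_zero_norm (fun t => ?_) (by simpa using hg.mul_const (∑ s, |U s|))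
    simp only [hb]
    rw [norm_mul, Real.norm_of_nonneg (pow_nonneg M.γ_nonneg t)]
    refine mul_le_mul_of_nonneg_left ?_ (pow_nonneg M.γ_nonneg t)
    have := norm_integral_le_of_norm_le_const (μ := T) (f := fun x => U (x t).1)
      (C := ∑ s, |U s|) (Eventually.of_forall fun x =>
        Finset.single_le_sum (f := fun s => |U s|) (fun _ _ => abs_nonneg _) (Finset.mem_univ _))
    simpa using this
  have htel : Tendsto (fun n => ∑ t ∈ Finset.range n, ∫ x, F t x ∂T) atTop (𝓝 (U s₀)) := by
    simp only [hFint, Finset.sum_range_sub', hb0]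
    simpa using hblim.const_sub (U s₀)
  exact tendsto_nhds_unique hHas.tendsto_sum_nat htel

end ValueFunction

/-! ### Moment matrices as linear functions of the sample statistics -/

section MomentMaps

variable {S A Z : Type*} [Fintype S] [Fintype A] [Fintype Z] {d : ℕ}

/-- The cell frequencies contained in a vector of statistics. -/
def cell : (StatIndex S A Z → ℝ) →ₗ[ℝ] (S × A × Z → ℝ) :=
  LinearMap.funLeft ℝ ℝ Sum.inl

theorem cell_apply (y : StatIndex S A Z → ℝ) (k : S × A × Z) : cell y k = y (.inl k) := rfl

/-- The frequency of the instrument value `z`. -/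
def instrMass (y : StatIndex S A Z → ℝ) (z : Z) : ℝ := ∑ s, ∑ a, y (.inl (s, a, z))

/-- `∑_z y(z) φ_r(z) φ_r(z)ᵀ`, where `y(z)` is the frequency of `z`. -/
def covAt (φ : S → A → Fin d → ℝ) (r : S × A × Z → ℝ) :
    (StatIndex S A Z → ℝ) →ₗ[ℝ] Matrix (Fin d) (Fin d) ℝ where
  toFun y := ∑ z, instrMass y z • Matrix.vecMulVec (condFeature φ r z) (condFeature φ r z)
  map_add' y y' := by simp [instrMass, Finset.sum_add_distrib, add_smul]
  map_smul' c y := by simp [instrMass, ← Finset.mul_sum, Finset.smul_sum, mul_smul]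

/-- `∑_z y(z) φ_r(z)`, where `y(z)` is the average reward on the event that the instrument
is `z`. -/
def tauAt (φ : S → A → Fin d → ℝ) (r : S × A × Z → ℝ) :
    (StatIndex S A Z → ℝ) →ₗ[ℝ] (Fin d → ℝ) where
  toFun y := ∑ z, y (.inr (.inl z)) • condFeature φ r z
  map_add' y y' := by simp [Finset.sum_add_distrib, add_smul]
  map_smul' c y := by simp [Finset.smul_sum, mul_smul]

/-- `∑_{z, s'} y(z, s') φ_r(z) φ_π(s')ᵀ`, where `y(z, s')` is the frequency of `(z, s')`. -/
def bAt (φ : S → A → Fin d → ℝ) (π : S → PMF A) (r : S × A × Z → ℝ) :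
    (StatIndex S A Z → ℝ) →ₗ[ℝ] Matrix (Fin d) (Fin d) ℝ where
  toFun y := ∑ z, ∑ s', y (.inr (.inr (z, s'))) •
    Matrix.vecMulVec (condFeature φ r z) (policyFeature φ π s')
  map_add' y y' := by simp [Finset.sum_add_distrib, add_smul]
  map_smul' c y := by simp [Finset.smul_sum, mul_smul]

theorem covAt_apply (φ : S → A → Fin d → ℝ) (r : S × A × Z → ℝ) (y : StatIndex S A Z → ℝ) :
    covAt φ r y = ∑ z, instrMass y z •
      Matrix.vecMulVec (condFeature φ r z) (condFeature φ r z) := rfl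

theorem tauAt_apply (φ : S → A → Fin d → ℝ) (r : S × A × Z → ℝ) (y : StatIndex S A Z → ℝ) :
    tauAt φ r y = ∑ z, y (.inr (.inl z)) • condFeature φ r z := rfl

theorem bAt_apply (φ : S → A → Fin d → ℝ) (π : S → PMF A) (r : S × A × Z → ℝ)
    (y : StatIndex S A Z → ℝ) :
    bAt φ π r y = ∑ z, ∑ s', y (.inr (.inr (z, s'))) •
      Matrix.vecMulVec (condFeature φ r z) (policyFeature φ π s') := rfl

variable [DecidableEq S] [DecidableEq A] [DecidableEq Z]

theorem instrMass_stat (x : Sample S A Z) (z : Z) :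
    instrMass (stat x) z = if x.2.2.1 = z then 1 else 0 := by
  simp only [instrMass, stat_cell, ite_and]
  simp

theorem covAt_stat (φ : S → A → Fin d → ℝ) (r : S × A × Z → ℝ) (x : Sample S A Z) :
    covAt φ r (stat x) =
      Matrix.vecMulVec (condFeature φ r x.instr) (condFeature φ r x.instr) := by
  simp [covAt_apply, instrMass_stat, ite_smul]

theorem tauAt_stat (φ : S → A → Fin d → ℝ) (r : S × A × Z → ℝ) (x : Sample S A Z) :
    tauAt φ r (stat x) = x.reward • condFeature φ r x.instr := by
  simp [tauAt_apply, stat_reward, ite_smul]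

theorem bAt_stat (φ : S → A → Fin d → ℝ) (π : S → PMF A) (r : S × A × Z → ℝ)
    (x : Sample S A Z) :
    bAt φ π r (stat x) =
      Matrix.vecMulVec (condFeature φ r x.instr) (policyFeature φ π x.next) := by
  simp only [bAt_apply, stat_next, ite_and, ite_smul, one_smul,
    zero_smul, Finset.sum_ite_irrel, Finset.sum_const_zero, Finset.sum_ite_eq, Finset.mem_univ,
    if_true]

end MomentMaps

/-! ### Population identities -/

section PopulationIdentities

variable {S A Z : Type*} [Fintype S] [Fintype A] [Fintype Z] {d : ℕ}

/-- `K = ∑_s ν(s) φ_π(s)ᵀ`, the matrix through which the transition operator of the target policy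
acts on linear value functions. -/
def transitionMatrix (φ : S → A → Fin d → ℝ) (π : S → PMF A) (ν : S → Fin d → ℝ) :
    Matrix (Fin d) (Fin d) ℝ :=
  ∑ s, Matrix.vecMulVec (ν s) (policyFeature φ π s)

theorem transitionMatrix_mulVec (φ : S → A → Fin d → ℝ) (π : S → PMF A) (ν : S → Fin d → ℝ)
    (v : Fin d → ℝ) :
    transitionMatrix φ π ν *ᵥ v = ∑ s, (policyFeature φ π s ⬝ᵥ v) • ν s := by
  rw [transitionMatrix, Matrix.sum_mulVec]
  simp [Matrix.vecMulVec_mulVec]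

theorem policyFeature_dotProduct (φ : S → A → Fin d → ℝ) (π : S → PMF A) (s : S)
    (v : Fin d → ℝ) :
    policyFeature φ π s ⬝ᵥ v = ∑ a, (π s a).toReal * (φ s a ⬝ᵥ v) := by
  simp [policyFeature, sum_dotProduct]

theorem condFeature_dotProduct (φ : S → A → Fin d → ℝ) (r : S × A × Z → ℝ) (z : Z)
    (v : Fin d → ℝ) :
    condFeature φ r z ⬝ᵥ v = ∑ s, ∑ a, r (s, a, z) * (φ s a ⬝ᵥ v) := by
  simp [condFeature, sum_dotProduct]

theorem LinearStructure.isUnit_one_sub_transitionMatrix {M : ConfoundedMDP S A}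
    {φ : S → A → Fin d → ℝ} {ν : S → Fin d → ℝ} {w : Fin d → ℝ} (h : LinearStructure M φ ν w)
    (π : S → PMF A) : IsUnit (1 - M.γ • transitionMatrix φ π ν) := by
  rw [← Matrix.mulVec_injective_iff_isUnit]
  refine (injective_iff_map_eq_zero
    (Matrix.mulVecLin (1 - M.γ • transitionMatrix φ π ν))).2 fun v hv => ?_
  have hv' : v = M.γ • (transitionMatrix φ π ν *ᵥ v) := by
    rw [Matrix.mulVecLin_apply, Matrix.sub_mulVec, Matrix.one_mulVec, Matrix.smul_mulVec,
      sub_eq_zero] at hv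
    exact hv
  have hQ : ∀ s s', policyFeature φ π s ⬝ᵥ ν s' =
      ∑ a, (π s a).toReal * (M.P s a s').toReal := fun s s' => by
    simp only [policyFeature_dotProduct, h.transition]
  have hu : (fun s => policyFeature φ π s ⬝ᵥ v) = 0 := by
    refine eq_zero_of_eq_discounted_average (Q := fun s s' => policyFeature φ π s ⬝ᵥ ν s')
      ?_ ?_ M.γ_nonneg M.γ_lt_one ?_
    · intro s s'
      rw [hQ]
      exact Finset.sum_nonneg fun a _ => mul_nonneg ENNReal.toReal_nonneg ENNReal.toReal_nonneg
    · intro s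
      simp only [hQ]
      rw [Finset.sum_comm]
      simp only [← Finset.mul_sum, pmf_sum_toReal, mul_one]
    · intro s
      conv_lhs => rw [hv']
      rw [dotProduct_smul, transitionMatrix_mulVec, dotProduct_sum, smul_eq_mul]
      simp only [dotProduct_smul, smul_eq_mul, mul_comm]
  rw [hv', transitionMatrix_mulVec]
  have hu' : ∀ s, policyFeature φ π s ⬝ᵥ v = 0 := fun s => congrFun hu s
  simp [hu']

variable [DecidableEq S] [DecidableEq A] [DecidableEq Z]
  [MeasurableSpace S] [MeasurableSpace A] [MeasurableSpace Z]
  [DiscreteMeasurableSpace S] [DiscreteMeasurableSpace A] [DiscreteMeasurableSpace Z]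

theorem integrable_linearMap_stat (M : ConfoundedMDP S A) (q : Sampling S A Z) {F : Type*}
    [NormedAddCommGroup F] [NormedSpace ℝ F] (L : (StatIndex S A Z → ℝ) →ₗ[ℝ] F) :
    Integrable (fun x => L (stat x)) (sampleLaw M q) :=
  (LinearMap.toContinuousLinearMap L).integrable_comp (integrable_stat M q)

theorem integral_linearMap_stat (M : ConfoundedMDP S A) (q : Sampling S A Z) {F : Type*}
    [NormedAddCommGroup F] [NormedSpace ℝ F] [CompleteSpace F]
    (L : (StatIndex S A Z → ℝ) →ₗ[ℝ] F) :
    ∫ x, L (stat x) ∂(sampleLaw M q) = L (meanStat M q) :=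
  (LinearMap.toContinuousLinearMap L).integral_comp_comm (integrable_stat M q)

theorem meanCount_eq_cell (M : ConfoundedMDP S A) (q : Sampling S A Z) :
    meanCount M q = cell (meanStat M q) :=
  integral_linearMap_stat M q cell

theorem instrMass_meanStat (M : ConfoundedMDP S A) (q : Sampling S A Z) (z : Z) :
    instrMass (meanStat M q) z = (q.p z).toReal := by
  simp only [instrMass, meanStat_count, ← Finset.mul_sum, Sampling.sum_rho, mul_one]

theorem dNormalize_cell_meanStat (M : ConfoundedMDP S A) {q : Sampling S A Z}
    (hp : ∀ z, q.p z ≠ 0) : dNormalize (cell (meanStat M q)) = q.rho := by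
  funext ⟨s, a, z⟩
  have hz : (q.p z).toReal ≠ 0 := ENNReal.toReal_ne_zero.2 ⟨hp z, q.p.apply_ne_top z⟩
  have h : ∑ s, ∑ a, cell (meanStat M q) (s, a, z) = (q.p z).toReal := instrMass_meanStat M q z
  simp only [dNormalize, h]
  rw [cell_apply, meanStat_count, mul_div_cancel_left₀ _ hz]
  rfl

theorem covAt_meanStat (M : ConfoundedMDP S A) (q : Sampling S A Z) (φ : S → A → Fin d → ℝ) :
    covAt φ q.rho (meanStat M q) = covMatrix q φ := by
  simp [covAt_apply, instrMass_meanStat, covMatrix]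

theorem tauAt_meanStat (M : ConfoundedMDP S A) (q : Sampling S A Z) (φ : S → A → Fin d → ℝ) :
    tauAt φ q.rho (meanStat M q) = tauVec M q φ := by
  funext k
  have := integral_linearMap_stat M q (LinearMap.proj k ∘ₗ tauAt φ q.rho)
  simp only [LinearMap.comp_apply, LinearMap.proj_apply, tauAt_stat] at this
  rw [← this, tauVec]
  simp [mul_comm]

theorem bAt_meanStat (M : ConfoundedMDP S A) (q : Sampling S A Z) (φ : S → A → Fin d → ℝ)
    (π : S → PMF A) : bAt φ π q.rho (meanStat M q) = bMatrix M q φ π := by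
  ext k l
  have := integral_linearMap_stat M q (Matrix.entryLinearMap ℝ ℝ k l ∘ₗ bAt φ π q.rho)
  simp only [LinearMap.comp_apply, Matrix.entryLinearMap_apply, bAt_stat] at this
  rw [← this, bMatrix]
  simp [Matrix.vecMulVec_apply]

/-- `B = Σ K`: given the instrument, the mean feature of the next state is `Kᵀ φ_ρ(z)`. -/
theorem LinearStructure.bMatrix_eq {M : ConfoundedMDP S A} {φ : S → A → Fin d → ℝ}
    {ν : S → Fin d → ℝ} {w : Fin d → ℝ} (h : LinearStructure M φ ν w) (q : Sampling S A Z)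
    (π : S → PMF A) : bMatrix M q φ π = covMatrix q φ * transitionMatrix φ π ν := by
  have hν : ∀ z s', ∑ s, ∑ a, (q.ρ z (s, a)).toReal * (M.P s a s').toReal =
      condFeature φ q.rho z ⬝ᵥ ν s' := fun z s' => by
    simp only [condFeature_dotProduct, h.transition, Sampling.rho]
  rw [← bAt_meanStat]
  simp only [bAt_apply, meanStat_next, hν, covMatrix, transitionMatrix,
    Finset.sum_mul, Finset.mul_sum, Matrix.smul_mul, Matrix.vecMulVec_mul_vecMulVec]
  rw [Finset.sum_comm]
  refine Finset.sum_congr rfl fun z _ => Finset.sum_congr rfl fun s' _ => ?_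
  simp [Matrix.vecMulVec_smul, mul_smul]

/-- `τ = Σ w`: the confounder does not contribute, by the instrumental variable assumption. -/
theorem LinearStructure.tauVec_eq {M : ConfoundedMDP S A} {φ : S → A → Fin d → ℝ}
    {ν : S → Fin d → ℝ} {w : Fin d → ℝ} (h : LinearStructure M φ ν w) {q : Sampling S A Z}
    (hiv : InstrumentalVariable M q) (hp : ∀ z, q.p z ≠ 0) :
    tauVec M q φ = covMatrix q φ *ᵥ w := by
  have hw : ∀ z, ∑ s, ∑ a, (q.ρ z (s, a)).toReal * M.R s a =
      condFeature φ q.rho z ⬝ᵥ w := fun z => by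
    simp only [condFeature_dotProduct, h.reward, Sampling.rho]
  rw [← tauAt_meanStat]
  simp only [tauAt_apply, meanStat_reward hiv hp, hw, covMatrix,
    Matrix.sum_mulVec, Matrix.smul_mulVec, Matrix.vecMulVec_mulVec]
  simp [mul_smul]

theorem LinearStructure.aMatrix_eq {M : ConfoundedMDP S A} {φ : S → A → Fin d → ℝ}
    {ν : S → Fin d → ℝ} {w : Fin d → ℝ} (h : LinearStructure M φ ν w) {q : Sampling S A Z}
    (hcov : IsUnit (covMatrix q φ).det) (π : S → PMF A) :
    aMatrix M q φ π = transitionMatrix φ π ν := by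
  rw [aMatrix, h.bMatrix_eq, ← Matrix.mul_assoc, Matrix.nonsing_inv_mul _ hcov, Matrix.one_mul]

/-- The identification of the value function: `V(s) = φ_π(s)ᵀ θ`. -/
theorem LinearStructure.value_eq {M : ConfoundedMDP S A} {φ : S → A → Fin d → ℝ}
    {ν : S → Fin d → ℝ} {w : Fin d → ℝ} (h : LinearStructure M φ ν w) {q : Sampling S A Z}
    (hiv : InstrumentalVariable M q) (hp : ∀ z, q.p z ≠ 0)
    (hcov : IsUnit (covMatrix q φ).det) (π : S → PMF A) {P₀ : ProbabilityMeasure ℝ}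
    (hP₀ : ∀ᵐ e ∂(P₀ : Measure ℝ), e ∈ M.E) (hmean : ∫ e, e ∂(P₀ : Measure ℝ) = 0) :
    value M π P₀ = fun s => policyFeature φ π s ⬝ᵥ theta M q φ π := by
  have hθ : theta M q φ π = w + M.γ • (transitionMatrix φ π ν *ᵥ theta M q φ π) := by
    have hdet := (Matrix.isUnit_iff_isUnit_det _).1 (h.isUnit_one_sub_transitionMatrix π)
    have h1 : (1 - M.γ • transitionMatrix φ π ν) *ᵥ theta M q φ π = w := by
      rw [theta, h.aMatrix_eq hcov, h.tauVec_eq hiv hp, Matrix.mulVec_mulVec, Matrix.mulVec_mulVec,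
        Matrix.mulVec_mulVec, Matrix.mul_nonsing_inv _ hdet, Matrix.one_mul,
        Matrix.nonsing_inv_mul _ hcov, Matrix.one_mulVec]
    rw [Matrix.sub_mulVec, Matrix.one_mulVec, Matrix.smul_mulVec] at h1
    exact sub_eq_iff_eq_add.1 h1
  refine value_eq_of_bellman M π hP₀ hmean fun s => ?_
  conv_lhs => rw [hθ]
  have hP : ∀ a, ∑ s', (M.P s a s').toReal * (policyFeature φ π s' ⬝ᵥ theta M q φ π) =
      φ s a ⬝ᵥ (transitionMatrix φ π ν *ᵥ theta M q φ π) := fun a => by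
    rw [transitionMatrix_mulVec, dotProduct_sum]
    simp only [dotProduct_smul, smul_eq_mul, h.transition, mul_comm]
  rw [policyFeature_dotProduct]
  refine Finset.sum_congr rfl fun a _ => ?_
  rw [hP, dotProduct_add, dotProduct_smul, h.reward, smul_eq_mul]

end PopulationIdentities

/-! ### Differential calculus -/

section Calculus

/-- At a zero of `g`, the product `c * g` is differentiable as soon as `g` is differentiable and `c`
is continuous. -/
theorem hasFDerivAt_mul_of_eq_zero {E : Type*} [NormedAddCommGroup E] [NormedSpace ℝ E]
    {c g : E → ℝ} {g' : E →L[ℝ] ℝ} {m : E} (hc : ContinuousAt c m) (hg : HasFDerivAt g g' m)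
    (h0 : g m = 0) : HasFDerivAt (fun y => c y * g y) (c m • g') m := by
  have h1 : HasFDerivAt (fun y => c m * g y) (c m • g') m := hg.const_mul (c m)
  have h2 : HasFDerivAt (fun y => (c y - c m) * g y) (0 : E →L[ℝ] ℝ) m := by
    rw [hasFDerivAt_iff_isLittleO]
    have hc' : (fun y => c y - c m) =o[𝓝 m] fun _ => (1 : ℝ) := by
      rw [Asymptotics.isLittleO_one_iff]
      simpa using hc.tendsto.sub_const (c m)
    have hg' : g =O[𝓝 m] fun y => y - m := by simpa [h0] using hg.isBigO_sub
    simpa [h0] using hc'.mul_isBigO hg'.norm_right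
  have hfun : (fun y => c y * g y) = (fun y => c m * g y) + fun y => (c y - c m) * g y := by
    funext y; simp only [Pi.add_apply]; ring
  rw [hfun]
  simpa using h1.add h2

theorem hasFDerivAt_mulVec_of_eq_zero {E : Type*} [NormedAddCommGroup E] [NormedSpace ℝ E] {d : ℕ}
    {J : E → Matrix (Fin d) (Fin d) ℝ} {g : E → Fin d → ℝ} {g' : E →L[ℝ] (Fin d → ℝ)} {m : E}
    (hJ : ContinuousAt J m) (hg : HasFDerivAt g g' m) (h0 : g m = 0) :
    HasFDerivAt (fun y => J y *ᵥ g y)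
      ((LinearMap.toContinuousLinearMap (Matrix.mulVecLin (J m))).comp g') m := by
  rw [hasFDerivAt_pi']
  intro k
  have h : ∀ l, HasFDerivAt (fun y => J y k l * g y l)
      (J m k l • (ContinuousLinearMap.proj l).comp g') m := fun l =>
    hasFDerivAt_mul_of_eq_zero
      ((continuousAt_pi.1 (continuousAt_pi.1 hJ k)) l) (hasFDerivAt_pi'.1 hg l) (congrFun h0 l)
  refine (HasFDerivAt.fun_sum (u := Finset.univ) fun l _ => h l).congr_fderiv ?_
  ext v
  simp [Matrix.mulVec, dotProduct, sum_apply]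

/-- The derivative of `y ↦ L (u y) y`, where `L r` is linear in `y`: the variations of the two
arguments add up. -/
theorem hasFDerivAt_linearMap_family {ι E F : Type*} [Fintype ι]
    [NormedAddCommGroup E] [NormedSpace ℝ E] [NormedAddCommGroup F] [NormedSpace ℝ F]
    {L : E → (ι → ℝ) →ₗ[ℝ] F} (hL : ∀ y, Differentiable ℝ fun r => L r y)
    {u : (ι → ℝ) → E} {u' : (ι → ℝ) →L[ℝ] E} {m : ι → ℝ} (hu : HasFDerivAt u u' m) :
    HasFDerivAt (fun y => L (u y) y) ((fderiv ℝ (fun r => L r m) (u m)).comp u' +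
      LinearMap.toContinuousLinearMap (L (u m))) m := by
  classical
  set e : ι → ι → ℝ := fun j => Pi.single j 1 with he
  have hexp : ∀ r y, L r y = ∑ j, y j • L r (e j) := fun r y => by
    rw [LinearMap.pi_apply_eq_sum_univ (L r) y]
    refine Finset.sum_congr rfl fun j _ => ?_
    congr 2
    funext i
    simp [he, Pi.single_apply, eq_comm]
  have hd : ∀ j, HasFDerivAt (fun y => y j • L (u y) (e j))
      (m j • (fderiv ℝ (fun r => L r (e j)) (u m)).comp u' +
        (ContinuousLinearMap.proj (R := ℝ) (φ := fun _ : ι => ℝ) j).smulRight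
          (L (u m) (e j))) m := fun j =>
    (hasFDerivAt_apply j m).smul
      (HasFDerivAt.comp m (hL (e j)).differentiableAt.hasFDerivAt hu)
  have hfd : fderiv ℝ (fun r => L r m) (u m) =
      ∑ j, m j • fderiv ℝ (fun r => L r (e j)) (u m) := by
    have : (fun r => L r m) = fun r => ∑ j, m j • L r (e j) := funext fun r => hexp r m
    rw [this]
    exact (HasFDerivAt.fun_sum fun j _ =>
      ((hL (e j)).differentiableAt.hasFDerivAt.const_smul (m j))).fderiv
  have hsum := HasFDerivAt.fun_sum (u := Finset.univ) fun j _ => hd j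
  have hfun : (fun y => L (u y) y) = fun y => ∑ j, y j • L (u y) (e j) :=
    funext fun y => hexp _ y
  rw [hfun]
  refine hsum.congr_fderiv ?_
  rw [Finset.sum_add_distrib, hfd]
  refine ContinuousLinearMap.ext fun v => ?_
  simp [sum_apply, hexp (u m) v]

theorem continuousAt_matrix_inv {E : Type*} [TopologicalSpace E] {d : ℕ}
    {C : E → Matrix (Fin d) (Fin d) ℝ} {m : E} (hC : ContinuousAt C m)
    (hdet : IsUnit (C m).det) : ContinuousAt (fun y => (C y)⁻¹) m := by
  have hadj : Continuous fun B : Matrix (Fin d) (Fin d) ℝ => B.adjugate :=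
    Continuous.matrix_adjugate continuous_id
  have hd : Continuous fun B : Matrix (Fin d) (Fin d) ℝ => B.det :=
    Continuous.matrix_det continuous_id
  simp only [Matrix.inv_def, Ring.inverse_eq_inv']
  exact ((hd.continuousAt.comp hC).inv₀ hdet.ne_zero).smul (hadj.continuousAt.comp hC)

end Calculus

/-! ### The estimator as a function of the empirical statistics -/

section EstimatorMap

variable {S A Z : Type*} [Fintype S] [Fintype A] [Fintype Z] {d : ℕ}

/-- The estimating function `τ - Σ θ + γ B θ`, with features `φ_r` and statistics `y`. -/
def residual (γ : ℝ) (φ : S → A → Fin d → ℝ) (π : S → PMF A) (θ : Fin d → ℝ)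
    (r : S × A × Z → ℝ) : (StatIndex S A Z → ℝ) →ₗ[ℝ] (Fin d → ℝ) where
  toFun y := tauAt φ r y - covAt φ r y *ᵥ θ + γ • (bAt φ π r y *ᵥ θ)
  map_add' y y' := by
    simp only [map_add, Matrix.add_mulVec, smul_add]; abel
  map_smul' c y := by
    simp only [map_smul, Matrix.smul_mulVec, RingHom.id_apply, smul_add, smul_sub]
    rw [smul_comm]

theorem residual_apply (γ : ℝ) (φ : S → A → Fin d → ℝ) (π : S → PMF A) (θ : Fin d → ℝ)
    (r : S × A × Z → ℝ) (y : StatIndex S A Z → ℝ) : residual γ φ π θ r y =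
      tauAt φ r y - covAt φ r y *ᵥ θ + γ • (bAt φ π r y *ᵥ θ) := rfl

theorem differentiable_condFeature (φ : S → A → Fin d → ℝ) (z : Z) (k : Fin d) :
    Differentiable ℝ fun r : S × A × Z → ℝ => condFeature φ r z k := by
  simp only [condFeature, Finset.sum_apply, Pi.smul_apply, smul_eq_mul]
  fun_prop

theorem differentiable_residual (γ : ℝ) (φ : S → A → Fin d → ℝ) (π : S → PMF A) (θ : Fin d → ℝ)
    (y : StatIndex S A Z → ℝ) :
    Differentiable ℝ fun r : S × A × Z → ℝ => residual γ φ π θ r y := by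
  have := differentiable_condFeature (Z := Z) φ
  rw [differentiable_pi]
  intro k
  simp only [residual_apply, tauAt_apply, covAt_apply, bAt_apply, Pi.add_apply, Pi.sub_apply,
    Pi.smul_apply, Finset.sum_apply, smul_eq_mul, Matrix.mulVec, dotProduct, Matrix.sum_apply,
    Matrix.smul_apply, Matrix.vecMulVec_apply]
  fun_prop

/-- `θ̂` as a function of the empirical statistics. -/
def thetaOf (γ : ℝ) (φ : S → A → Fin d → ℝ) (π : S → PMF A) (y : StatIndex S A Z → ℝ) :
    Fin d → ℝ :=
  (1 - γ • ((covAt φ (dNormalize (cell y)) y)⁻¹ * bAt φ π (dNormalize (cell y)) y))⁻¹ *ᵥ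
    ((covAt φ (dNormalize (cell y)) y)⁻¹ *ᵥ tauAt φ (dNormalize (cell y)) y)

/-- The matrix `(I - γ Â)⁻¹ Σ̂⁻¹` as a function of the empirical statistics. -/
def gain (γ : ℝ) (φ : S → A → Fin d → ℝ) (π : S → PMF A) (y : StatIndex S A Z → ℝ) :
    Matrix (Fin d) (Fin d) ℝ :=
  (1 - γ • ((covAt φ (dNormalize (cell y)) y)⁻¹ * bAt φ π (dNormalize (cell y)) y))⁻¹ *
    (covAt φ (dNormalize (cell y)) y)⁻¹

/-- The estimation error is the residual of the estimating equation at `θ`, multiplied by the gain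
matrix. -/
theorem thetaOf_eq_add_gain_mulVec_residual {γ : ℝ} {φ : S → A → Fin d → ℝ} {π : S → PMF A}
    {y : StatIndex S A Z → ℝ} (hC : IsUnit (covAt φ (dNormalize (cell y)) y).det)
    (hA : IsUnit (1 - γ • ((covAt φ (dNormalize (cell y)) y)⁻¹ *
      bAt φ π (dNormalize (cell y)) y)).det) (θ : Fin d → ℝ) :
    thetaOf γ φ π y = θ + gain γ φ π y *ᵥ residual γ φ π θ (dNormalize (cell y)) y := by
  rw [thetaOf, gain, residual_apply]
  generalize covAt φ (dNormalize (cell y)) y = C at *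
  generalize bAt φ π (dNormalize (cell y)) y = B at *
  generalize tauAt φ (dNormalize (cell y)) y = τ at *
  have h1 : C⁻¹ *ᵥ (τ - C *ᵥ θ + γ • (B *ᵥ θ)) = C⁻¹ *ᵥ τ - (1 - γ • (C⁻¹ * B)) *ᵥ θ := by
    rw [Matrix.mulVec_add, Matrix.mulVec_sub, Matrix.mulVec_smul, Matrix.mulVec_mulVec,
      Matrix.mulVec_mulVec, Matrix.nonsing_inv_mul _ hC, Matrix.sub_mulVec, Matrix.smul_mulVec]
    abel
  rw [← Matrix.mulVec_mulVec, h1, Matrix.mulVec_sub,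
    Matrix.mulVec_mulVec (M := (_ : Matrix _ _ ℝ)⁻¹) (N := 1 - γ • (C⁻¹ * B)),
    Matrix.nonsing_inv_mul _ hA, Matrix.one_mulVec]
  abel

theorem continuousAt_dNormalize_cell {m : StatIndex S A Z → ℝ}
    (hd : DifferentiableAt ℝ dNormalize (cell m)) :
    ContinuousAt (fun y : StatIndex S A Z → ℝ => dNormalize (cell y)) m :=
  ContinuousAt.comp (g := dNormalize) hd.continuousAt
    (LinearMap.toContinuousLinearMap cell).continuous.continuousAt

theorem continuousAt_covAt (φ : S → A → Fin d → ℝ) {m : StatIndex S A Z → ℝ}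
    (hd : DifferentiableAt ℝ dNormalize (cell m)) :
    ContinuousAt (fun y => covAt φ (dNormalize (cell y)) y) m := by
  have h := fun z k => (differentiable_condFeature (Z := Z) φ z k).continuous.continuousAt.comp
    (continuousAt_dNormalize_cell hd)
  refine continuousAt_pi.2 fun k => continuousAt_pi.2 fun l => ?_
  simp only [covAt_apply, Matrix.sum_apply, Matrix.smul_apply, Matrix.vecMulVec_apply, smul_eq_mul,
    instrMass]
  refine tendsto_finsetSum _ fun z _ => ContinuousAt.mul ?_ ((h z k).mul (h z l))
  exact tendsto_finsetSum _ fun s _ => tendsto_finsetSum _ fun a _ => continuousAt_apply _ _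

theorem continuousAt_bAt (φ : S → A → Fin d → ℝ) (π : S → PMF A) {m : StatIndex S A Z → ℝ}
    (hd : DifferentiableAt ℝ dNormalize (cell m)) :
    ContinuousAt (fun y => bAt φ π (dNormalize (cell y)) y) m := by
  have h := fun z k => (differentiable_condFeature (Z := Z) φ z k).continuous.continuousAt.comp
    (continuousAt_dNormalize_cell hd)
  refine continuousAt_pi.2 fun k => continuousAt_pi.2 fun l => ?_
  simp only [bAt_apply, Matrix.sum_apply, Matrix.smul_apply, Matrix.vecMulVec_apply, smul_eq_mul]
  exact tendsto_finsetSum _ fun z _ => tendsto_finsetSum _ fun s' _ =>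
    (continuousAt_apply _ m).mul ((h z k).mul continuousAt_const)

/-- The derivative of `θ̂` at a point where the two inverses exist.  Since the residual vanishes
there, only the residual is differentiated, and the gain matrix is frozen. -/
theorem hasFDerivAt_thetaOf {γ : ℝ} {φ : S → A → Fin d → ℝ} {π : S → PMF A}
    {m : StatIndex S A Z → ℝ} (hd : DifferentiableAt ℝ dNormalize (cell m))
    (hC : IsUnit (covAt φ (dNormalize (cell m)) m).det)
    (hA : IsUnit (1 - γ • ((covAt φ (dNormalize (cell m)) m)⁻¹ *
      bAt φ π (dNormalize (cell m)) m)).det) :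
    HasFDerivAt (thetaOf γ φ π)
      ((LinearMap.toContinuousLinearMap (Matrix.mulVecLin (gain γ φ π m))).comp
        ((fderiv ℝ (fun r => residual γ φ π (thetaOf γ φ π m) r m) (dNormalize (cell m))).comp
          ((fderiv ℝ dNormalize (cell m)).comp (LinearMap.toContinuousLinearMap cell)) +
        LinearMap.toContinuousLinearMap
          (residual γ φ π (thetaOf γ φ π m) (dNormalize (cell m))))) m := by
  set θ := thetaOf γ φ π m with hθ
  have hCc := continuousAt_covAt φ hd
  have hCi := continuousAt_matrix_inv hCc hC
  have hAc : ContinuousAt (fun y => 1 - γ • ((covAt φ (dNormalize (cell y)) y)⁻¹ *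
      bAt φ π (dNormalize (cell y)) y)) m :=
    continuousAt_const.sub ((hCi.mul (continuousAt_bAt φ π hd)).const_smul γ)
  have hgain : ContinuousAt (gain γ φ π) m := (continuousAt_matrix_inv hAc hA).mul hCi
  have hdet : Continuous fun B : Matrix (Fin d) (Fin d) ℝ => B.det :=
    Continuous.matrix_det continuous_id
  have hCev : ∀ᶠ y in 𝓝 m, IsUnit (covAt φ (dNormalize (cell y)) y).det :=
    ((hdet.continuousAt.comp hCc).eventually_ne hC.ne_zero).mono fun y hy => isUnit_iff_ne_zero.2 hy
  have hAev : ∀ᶠ y in 𝓝 m, IsUnit (1 - γ • ((covAt φ (dNormalize (cell y)) y)⁻¹ *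
      bAt φ π (dNormalize (cell y)) y)).det :=
    ((hdet.continuousAt.comp hAc).eventually_ne hA.ne_zero).mono fun y hy => isUnit_iff_ne_zero.2 hy
  have hu : HasFDerivAt (fun y : StatIndex S A Z → ℝ => dNormalize (cell y))
      ((fderiv ℝ dNormalize (cell m)).comp (LinearMap.toContinuousLinearMap cell)) m :=
    HasFDerivAt.comp m hd.hasFDerivAt (LinearMap.toContinuousLinearMap cell).hasFDerivAt
  have hres := hasFDerivAt_linearMap_family (differentiable_residual (Z := Z) γ φ π θ) hu
  have h0 : residual γ φ π θ (dNormalize (cell m)) m = 0 := by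
    have hg : IsUnit (gain γ φ π m) := by
      rw [Matrix.isUnit_iff_isUnit_det, gain, Matrix.det_mul]
      exact (Matrix.isUnit_nonsing_inv_det _ hA).mul (Matrix.isUnit_nonsing_inv_det _ hC)
    refine Matrix.mulVec_injective_iff_isUnit.2 hg ?_
    have := thetaOf_eq_add_gain_mulVec_residual hC hA θ
    rw [← hθ, left_eq_add] at this
    simpa using this
  have hprod := (hasFDerivAt_mulVec_of_eq_zero hgain hres h0).const_add θ
  refine hprod.congr_of_eventuallyEq ?_
  filter_upwards [hCev, hAev] with y hy hy'
  exact thetaOf_eq_add_gain_mulVec_residual hy hy' θ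

end EstimatorMap

/-! ### The estimator and the influence function in terms of the statistics -/

section Plugin

variable {S A Z : Type*} [Fintype S] [Fintype A] [Fintype Z]
  [DecidableEq S] [DecidableEq A] [DecidableEq Z] {d n : ℕ}

/-- The empirical mean of the sample statistics. -/
def empiricalStat (D : Fin n → Sample S A Z) : StatIndex S A Z → ℝ :=
  (n : ℝ)⁻¹ • ∑ i, stat (D i)

/-- The truncation of the denominator in `ρ̂` has no effect: where the denominator vanishes the
numerator does too, and `0 / 0 = 0`. -/
theorem rhoHat_eq (D : Fin n → Sample S A Z) :
    rhoHat D = dNormalize (cell (empiricalStat D)) := by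
  funext ⟨s, a, z⟩
  have hnum : cell (empiricalStat D) (s, a, z) = (n : ℝ)⁻¹ *
      ∑ i, if (D i).state = s ∧ (D i).action = a ∧ (D i).instr = z then (1 : ℝ) else 0 := by
    simp only [cell_apply, empiricalStat, Pi.smul_apply, Finset.sum_apply, smul_eq_mul]
    rfl
  have hden : ∑ s, ∑ a, cell (empiricalStat D) (s, a, z) = (n : ℝ)⁻¹ *
      ∑ i, if (D i).instr = z then (1 : ℝ) else 0 := by
    simp only [cell_apply, empiricalStat, Pi.smul_apply, Finset.sum_apply, smul_eq_mul,
      ← Finset.mul_sum]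
    congr 1
    simp only [← instrMass_stat, instrMass]
    rw [Finset.sum_comm]
    rw [Finset.sum_congr rfl fun a _ => Finset.sum_comm, Finset.sum_comm]
    exact Finset.sum_congr rfl fun i _ => Finset.sum_comm
  simp only [rhoHat, dNormalize, hden]
  rw [hnum]
  rcases Nat.eq_zero_or_pos n with rfl | hn
  · simp
  have hn' : (n : ℝ)⁻¹ ≠ 0 := inv_ne_zero (by exact_mod_cast hn.ne')
  rw [mul_div_mul_left _ _ hn']
  have hcast : ∑ i, (if (D i).instr = z then (1 : ℝ) else 0) =
      ((Finset.univ.filter fun i => (D i).instr = z).card : ℝ) := by simp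
  rcases Nat.eq_zero_or_pos (Finset.univ.filter fun i => (D i).instr = z).card with h0 | hpos
  · have hz : ∀ i, (D i).instr ≠ z := by simpa [Finset.filter_eq_empty_iff] using h0
    have : ∀ i, ¬ ((D i).state = s ∧ (D i).action = a ∧ (D i).instr = z) :=
      fun i hi => hz i hi.2.2
    simp only [this, if_false, Finset.sum_const_zero, zero_div]
  · rw [max_eq_left]
    rw [hcast]
    exact_mod_cast hpos

theorem linearMap_empiricalStat {F : Type*} [AddCommGroup F] [Module ℝ F]
    (L : (StatIndex S A Z → ℝ) →ₗ[ℝ] F) (D : Fin n → Sample S A Z) :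
    L (empiricalStat D) = (n : ℝ)⁻¹ • ∑ i, L (stat (D i)) := by
  rw [empiricalStat, map_smul, map_sum]

theorem thetaHat_eq (γ : ℝ) (φ : S → A → Fin d → ℝ) (π : S → PMF A) (D : Fin n → Sample S A Z) :
    thetaHat γ φ π D = thetaOf γ φ π (empiricalStat D) := by
  rw [thetaOf, ← rhoHat_eq]
  simp only [linearMap_empiricalStat, covAt_stat, tauAt_stat, bAt_stat]
  rfl

theorem differentiableAt_dNormalize {x : S × A × Z → ℝ}
    (hx : ∀ z, ∑ s, ∑ a, x (s, a, z) ≠ 0) : DifferentiableAt ℝ dNormalize x := by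
  rw [differentiableAt_pi]
  intro y
  simp only [dNormalize, div_eq_mul_inv]
  have hsum : DifferentiableAt ℝ (fun x : S × A × Z → ℝ => ∑ s, ∑ a, x (s, a, y.2.2)) x := by
    fun_prop
  exact (differentiableAt_apply y x).mul (hsum.inv (hx y.2.2))

variable [MeasurableSpace S] [MeasurableSpace A] [MeasurableSpace Z]
  [DiscreteMeasurableSpace S] [DiscreteMeasurableSpace A] [DiscreteMeasurableSpace Z]

theorem thetaOf_meanStat (M : ConfoundedMDP S A) {q : Sampling S A Z} (φ : S → A → Fin d → ℝ)
    (π : S → PMF A) (hp : ∀ z, q.p z ≠ 0) :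
    thetaOf M.γ φ π (meanStat M q) = theta M q φ π := by
  rw [thetaOf, dNormalize_cell_meanStat M hp, covAt_meanStat, bAt_meanStat, tauAt_meanStat]
  rfl

theorem gain_meanStat (M : ConfoundedMDP S A) {q : Sampling S A Z} (φ : S → A → Fin d → ℝ)
    (π : S → PMF A) (hp : ∀ z, q.p z ≠ 0) :
    gain M.γ φ π (meanStat M q) = (1 - M.γ • aMatrix M q φ π)⁻¹ * (covMatrix q φ)⁻¹ := by
  rw [gain, dNormalize_cell_meanStat M hp, covAt_meanStat, bAt_meanStat]
  rfl

/-- The score `f(x; r)` as a linear function of the statistics of `x`. -/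
def scoreMap (M : ConfoundedMDP S A) (q : Sampling S A Z) (φ : S → A → Fin d → ℝ)
    (π : S → PMF A) (r : S × A × Z → ℝ) : (StatIndex S A Z → ℝ) →ₗ[ℝ] (Fin d → ℝ) :=
  Matrix.mulVecLin ((1 - M.γ • aMatrix M q φ π)⁻¹ * (covMatrix q φ)⁻¹) ∘ₗ
    residual M.γ φ π (theta M q φ π) r

theorem scoreMap_stat (M : ConfoundedMDP S A) (q : Sampling S A Z) (φ : S → A → Fin d → ℝ)
    (π : S → PMF A) (r : S × A × Z → ℝ) (x : Sample S A Z) :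
    scoreMap M q φ π r (stat x) = fScore M q φ π x r := by
  have h : residual M.γ φ π (theta M q φ π) r (stat x) =
      (x.reward + M.γ * (policyFeature φ π x.next ⬝ᵥ theta M q φ π)
        - condFeature φ r x.instr ⬝ᵥ theta M q φ π) • condFeature φ r x.instr := by
    rw [residual_apply, tauAt_stat, covAt_stat, bAt_stat, Matrix.vecMulVec_mulVec,
      Matrix.vecMulVec_mulVec]
    simp only [op_smul_eq_smul, sub_smul, add_smul, mul_smul]
    abel
  rw [scoreMap, LinearMap.comp_apply, h, map_smul]
  rfl

theorem meanScore_eq (M : ConfoundedMDP S A) (q : Sampling S A Z) (φ : S → A → Fin d → ℝ)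
    (π : S → PMF A) : meanScore M q φ π = fun r => scoreMap M q φ π r (meanStat M q) := by
  funext r
  simp only [meanScore, ← scoreMap_stat]
  exact integral_linearMap_stat M q _

theorem hasFDerivAt_meanScore (M : ConfoundedMDP S A) (q : Sampling S A Z)
    (φ : S → A → Fin d → ℝ) (π : S → PMF A) (r : S × A × Z → ℝ) :
    HasFDerivAt (meanScore M q φ π)
      ((LinearMap.toContinuousLinearMap (Matrix.mulVecLin
        ((1 - M.γ • aMatrix M q φ π)⁻¹ * (covMatrix q φ)⁻¹))).comp
          (fderiv ℝ (fun r => residual M.γ φ π (theta M q φ π) r (meanStat M q)) r)) r := by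
  rw [meanScore_eq]
  exact HasFDerivAt.comp r (LinearMap.toContinuousLinearMap (Matrix.mulVecLin
    ((1 - M.γ • aMatrix M q φ π)⁻¹ * (covMatrix q φ)⁻¹))).hasFDerivAt
    (differentiable_residual M.γ φ π (theta M q φ π) (meanStat M q)).differentiableAt.hasFDerivAt

/-- The influence function as a linear function of the statistics. -/
def influenceMap (M : ConfoundedMDP S A) (q : Sampling S A Z) (φ : S → A → Fin d → ℝ)
    (π : S → PMF A) : (StatIndex S A Z → ℝ) →ₗ[ℝ] (Fin d → ℝ) :=
  scoreMap M q φ π q.rho +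
    ((fderiv ℝ (meanScore M q φ π) q.rho).comp (fderiv ℝ dNormalize (meanCount M q))).toLinearMap
      ∘ₗ cell

theorem influenceMap_stat (M : ConfoundedMDP S A) (q : Sampling S A Z) (φ : S → A → Fin d → ℝ)
    (π : S → PMF A) (x : Sample S A Z) :
    influenceMap M q φ π (stat x) = influence M q φ π x := by
  rw [influenceMap, LinearMap.add_apply, scoreMap_stat]
  rfl

theorem differentiableAt_dNormalize_meanCount (M : ConfoundedMDP S A) {q : Sampling S A Z}
    (hp : ∀ z, q.p z ≠ 0) : DifferentiableAt ℝ dNormalize (meanCount M q) := by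
  refine differentiableAt_dNormalize fun z => ?_
  rw [meanCount_eq_cell]
  have := instrMass_meanStat M q z
  simp only [instrMass] at this
  simp only [cell_apply, this]
  exact ENNReal.toReal_ne_zero.2 ⟨hp z, q.p.apply_ne_top z⟩

/-- The influence function is the derivative, at the population statistics, of the estimator as a
function of the empirical statistics. -/
theorem hasFDerivAt_thetaOf_meanStat (M : ConfoundedMDP S A) {q : Sampling S A Z}
    (φ : S → A → Fin d → ℝ) (π : S → PMF A) (hp : ∀ z, q.p z ≠ 0)
    (hC : IsUnit (covMatrix q φ).det) (hA : IsUnit (1 - M.γ • aMatrix M q φ π)) :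
    HasFDerivAt (thetaOf M.γ φ π) (LinearMap.toContinuousLinearMap (influenceMap M q φ π))
      (meanStat M q) := by
  have hd := differentiableAt_dNormalize_meanCount M hp
  have hd' := hd
  rw [meanCount_eq_cell] at hd'
  have h := hasFDerivAt_thetaOf (γ := M.γ) (φ := φ) (π := π) hd'
    (by rwa [dNormalize_cell_meanStat M hp, covAt_meanStat])
    (by
      rw [dNormalize_cell_meanStat M hp, covAt_meanStat, bAt_meanStat]
      exact (Matrix.isUnit_iff_isUnit_det _).1 hA)
  rw [gain_meanStat M φ π hp, thetaOf_meanStat M φ π hp, dNormalize_cell_meanStat M hp] at h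
  refine h.congr_fderiv (ContinuousLinearMap.ext fun v => ?_)
  change _ = influenceMap M q φ π v
  rw [influenceMap, (hasFDerivAt_meanScore M q φ π q.rho).fderiv, meanCount_eq_cell]
  simp only [ContinuousLinearMap.comp_apply, add_apply, map_add]
  exact add_comm _ _

end Plugin

end ConfoundedOPE

end

/-! ### Asymptotic linearity -/

open ConfoundedOPE in
theorem mainTheorem2
    {S A Z : Type*} [Fintype S] [Fintype A] [Fintype Z]
    [DecidableEq S] [DecidableEq A] [DecidableEq Z]
    [MeasurableSpace S] [MeasurableSpace A] [MeasurableSpace Z]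
    [DiscreteMeasurableSpace S] [DiscreteMeasurableSpace A] [DiscreteMeasurableSpace Z]
    {d : ℕ}
    -- the confounded MDP, the offline sampling mechanism, the features, the target policy
    (M : ConfoundedMDP S A) (q : Sampling S A Z) (φ : S → A → Fin d → ℝ) (π : S → PMF A)
    -- the zero-mean confounder law of the evaluation trajectories
    (P₀ : ProbabilityMeasure ℝ) (hP₀_mem : ∀ᵐ e ∂(P₀ : Measure ℝ), e ∈ M.E)
    (hP₀_mean : ∫ e, e ∂(P₀ : Measure ℝ) = 0)
    -- every value of the instrument has positive probability
    (hp : ∀ z, q.p z ≠ 0)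
    -- the three assumptions: linear structure, instrumental variable, coverage
    (hlin : ∃ (ν : S → Fin d → ℝ) (w : Fin d → ℝ), LinearStructure M φ ν w)
    (hiv : InstrumentalVariable M q)
    (hcov : (covMatrix q φ).PosDef)
    -- the i.i.d. samples
    {Ω : Type*} [MeasurableSpace Ω] (μ : Measure Ω) [IsProbabilityMeasure μ]
    (X : ℕ → Ω → Sample S A Z) (hX_law : ∀ i, HasLaw (X i) (sampleLaw M q) μ)
    (hX_indep : iIndepFun X μ) :
    -- the quantities in the expansion are well defined
    IsUnit (1 - M.γ • aMatrix M q φ π) ∧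
    (∀ r, Integrable (fun x => fScore M q φ π x r) (sampleLaw M q)) ∧
    DifferentiableAt ℝ (meanScore M q φ π) q.rho ∧
    DifferentiableAt ℝ dNormalize (meanCount M q) ∧
    Integrable (influence M q φ π) (sampleLaw M q) ∧
    -- asymptotic linearity
    TendstoInMeasure μ
      (fun (n : ℕ) (ω : Ω) =>
        √(n : ℝ) • (valueHat M.γ φ π (fun i : Fin n => X i ω) - value M π P₀) -
          (√(n : ℝ))⁻¹ • ∑ i : Fin n, (policyMatrix φ π)ᵀ *ᵥ
            (influence M q φ π (X i ω) - ∫ x, influence M q φ π x ∂(sampleLaw M q)))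
      atTop (fun _ => (0 : S → ℝ)) := by
  obtain ⟨ν, w, h⟩ := hlin
  have hC : IsUnit (covMatrix q φ).det := isUnit_iff_ne_zero.2 hcov.det_pos.ne'
  have hA : IsUnit (1 - M.γ • aMatrix M q φ π) := by
    rw [h.aMatrix_eq hC]
    exact h.isUnit_one_sub_transitionMatrix π
  have hinf : influence M q φ π = fun x => influenceMap M q φ π (stat x) :=
    funext fun x => (influenceMap_stat M q φ π x).symm
  refine ⟨hA, fun r => ?_, (hasFDerivAt_meanScore M q φ π q.rho).differentiableAt,
    differentiableAt_dNormalize_meanCount M hp, ?_, ?_⟩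
  · simp only [← scoreMap_stat]
    exact integrable_linearMap_stat M q _
  · rw [hinf]
    exact integrable_linearMap_stat M q _
  set Φ : (Fin d → ℝ) →L[ℝ] (S → ℝ) :=
    LinearMap.toContinuousLinearMap (Matrix.mulVecLin (policyMatrix φ π)ᵀ)
  set L : (StatIndex S A Z → ℝ) →L[ℝ] (Fin d → ℝ) :=
    LinearMap.toContinuousLinearMap (influenceMap M q φ π)
  have hF : HasFDerivAt (fun y => Φ (thetaOf M.γ φ π y)) (Φ.comp L) (meanStat M q) :=
    HasFDerivAt.comp _ Φ.hasFDerivAt (hasFDerivAt_thetaOf_meanStat M φ π hp hC hA)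
  have hmain := tendstoInMeasure_linearization (μ := μ)
    (Y := fun n ω => empiricalStat fun i : Fin n => X i ω) hF
    (boundedInProbability_mean hX_law hX_indep measurable_stat (ae_abs_stat_le M q))
  refine hmain.congr_left fun n => Eventually.of_forall fun ω => ?_
  have hV : value M π P₀ = Φ (thetaOf M.γ φ π (meanStat M q)) := by
    rw [h.value_eq hiv hp hC π hP₀_mem hP₀_mean, thetaOf_meanStat M φ π hp]
    rfl
  have hVhat : valueHat M.γ φ π (fun i : Fin n => X i ω) =
      Φ (thetaOf M.γ φ π (empiricalStat fun i : Fin n => X i ω)) := by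
    rw [← thetaHat_eq]
    rfl
  have hlinear : √(n : ℝ) • (Φ.comp L) ((empiricalStat fun i : Fin n => X i ω) - meanStat M q) =
      (√(n : ℝ))⁻¹ • ∑ i : Fin n, (policyMatrix φ π)ᵀ *ᵥ
        (influence M q φ π (X i ω) - ∫ x, influence M q φ π x ∂(sampleLaw M q)) := by
    have hterm : ∀ i : Fin n, (policyMatrix φ π)ᵀ *ᵥ
        (influence M q φ π (X i ω) - ∫ x, influence M q φ π x ∂(sampleLaw M q)) =
        (Φ.comp L) (stat (X i ω) - meanStat M q) := fun i => by
      rw [hinf, integral_linearMap_stat, ← map_sub]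
      rfl
    simp only [hterm, ← map_sum, ← map_smul]
    congr 1
    rw [Finset.sum_sub_distrib, empiricalStat]
    -- for `n = 0` both sides are multiplied by zero, since `√0 = 0` and `0⁻¹ = 0`
    rcases Nat.eq_zero_or_pos n with rfl | hn
    · simp
    have hn' : (0 : ℝ) < n := by exact_mod_cast hn
    have hs : (√(n : ℝ))⁻¹ = √(n : ℝ) * (n : ℝ)⁻¹ := by
      rw [← div_eq_mul_inv, Real.sqrt_div_self]
    rw [hs, mul_smul, smul_sub (n : ℝ)⁻¹, Finset.sum_const, Finset.card_univ, Fintype.card_fin,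
      ← Nat.cast_smul_eq_nsmul ℝ, smul_smul (n : ℝ)⁻¹ (n : ℝ), inv_mul_cancel₀ hn'.ne', one_smul]
  beta_reduce
  rw [hV, hVhat, ← hlinear]
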